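/- Let $\tau:E\to M$ and $\tau':E'\to M'$ be Lie algebroids over smooth (Hausdorff, finite-dimensional) manifolds, with anchors $\rho,\rho'$. Let $\Phi:E\to E'$ be a Lie algebroid morphism over a smooth map $\varphi:M\to M'$, i.e. a smooth vector bundle map with $\Phi^\star d\theta=d\Phi^\star\theta$ for all forms $\theta\in\mathrm{Sec}(\bigwedge^p (E')^*)$, $p\ge 0$. Assume that $\Phi$ is fiberwise surjective. The prolongation $\mathcal T^EE\to E$ is the Lie algebroid with fibre $\{(b,v)\in E_m\times T_aE : \rho(b)=T_a\tau(v)\}$ at $a\in E_m$, anchor $\rho^1(a,b,v)=v$, and bracket determined by $[Z_1,Z_2]=([\sigma_1,\sigma_2]\circ\tau,[X_1,X_2])$ for projectable sections $Z_i=(\sigma_i\circ\tau,X_i)$. Write $b_a^V\in T_aE$ for the vector tangent to $t\mapsto a+tb$ at $t=0$. For $L\in C^\infty(E)$ let $\theta_L(a,b,v)=dL(a,0,b_a^V)$, $\omega_L=-d\theta_L$, and $E_L(a)=dL(a,0,a_a^V)-L(a)$, where $d$ is the differential of $\mathcal T^EE$. $L$ is regular if $\omega_L$ is nondegenerate at every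 point of $E$. A section $\Gamma$ of $\mathcal T^EE$ solves the free dynamics of $L$ if $i_\Gamma\omega_L=dE_L$; a curve in $E$ is then a solution of the free dynamics if it is an integral curve of the vector field $\rho^1(\Gamma)$. The same notions are used on $E'$. Finally, $\mathcal T^\Phi\Phi(a,b,v)=(\Phi(a),\Phi(b),T_a\Phi(v))$. **Theorem (Reduction of the free dynamics).** Let $L\in C^\infty(E)$ and $L'\in C^\infty(E')$ satisfy $L=L'\circ\Phi$, and let $L$ be regular. 1. $\omega_{L'}$ is nondegenerate at every point of $\Phi(E)$. In particular, if $\varphi$ is surjective, then $L'$ is a regular Lagrangian. 2. The equation $i_\Gamma\omega_L=dE_L$ has at each point of $E$ a unique solution, and so defines $\Gamma_L$. If $\varphi$ is surjective, the same holds for $L'$ and defines $\Gamma_{L'}$. 3. If $\Gamma_L$ and $\Gamma_{L'}$ are solutions of the free dynamics of $L$ and $L'$, then $\mathcal T^\Phi\Phi\circ\Gamma_L=\Gamma_{L'}\circ\Phi$. Consequently, if $a(t)$ is an integral curve of $\rho^1(\Gamma_L)$, then $\Phi(a(t))$ is an integral curve of $\rho^1(\Gamma_{L'})$. -/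

import Mathlib

open Bundle
open scoped Manifold ContDiff Bundle

noncomputable section

namespace LieAlgd

/-- `v f`: the derivative of the real function `f` along the tangent vector `v` at `x`. -/
def dirDeriv {E : Type*} [NormedAddCommGroup E] [NormedSpace ℝ E]
    {K : Type*} [TopologicalSpace K] (I : ModelWithCorners ℝ E K)
    {N : Type*} [TopologicalSpace N] [ChartedSpace K N]
    (f : N → ℝ) (x : N) (v : TangentSpace I x) : ℝ :=
  mfderiv I 𝓘(ℝ, ℝ) f x v

section OneBundle

variable {H : Type*} [NormedAddCommGroup H] [NormedSpace ℝ H]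
  {M : Type*} [TopologicalSpace M] [ChartedSpace H M] [IsManifold 𝓘(ℝ, H) ∞ M]
  {F : Type*} [NormedAddCommGroup F] [NormedSpace ℝ F]
  {V : M → Type*} [TopologicalSpace (TotalSpace F V)]
  [∀ x, TopologicalSpace (V x)] [∀ x, AddCommGroup (V x)] [∀ x, Module ℝ (V x)]
  [FiberBundle F V] [VectorBundle ℝ F V] [ContMDiffVectorBundle ∞ F V 𝓘(ℝ, H)]

/-- The product `f σ` of a smooth function and a smooth section. -/
def smulSection (f : C^∞⟮𝓘(ℝ, H), M; ℝ⟯) (σ : Cₛ^∞⟮𝓘(ℝ, H); F, V⟯) :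
    Cₛ^∞⟮𝓘(ℝ, H); F, V⟯ where
  toFun x := f x • σ x
  contMDiff_toFun := f.contMDiff.smul_section σ.contMDiff

variable (H F V) in
/-- A Lie algebroid structure on the smooth vector bundle `V` (with model fibre `F`) over the
manifold `M` (modelled on `H`): a smooth vector bundle map `V → TM` over the identity, and a real
Lie algebra structure on the smooth sections, with
`[σ, f η] = f [σ, η] + (ρ(σ) f) η`. -/
structure LieAlgebroid where
  anchor : ∀ x, V x →ₗ[ℝ] TangentSpace 𝓘(ℝ, H) x
  contMDiff_anchor : ContMDiff (𝓘(ℝ, H).prod 𝓘(ℝ, F)) 𝓘(ℝ, H).tangent ∞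
    (fun a : TotalSpace F V ↦ (⟨a.proj, anchor a.proj a.2⟩ : TangentBundle 𝓘(ℝ, H) M))
  bracket : Cₛ^∞⟮𝓘(ℝ, H); F, V⟯ →ₗ[ℝ] Cₛ^∞⟮𝓘(ℝ, H); F, V⟯ →ₗ[ℝ] Cₛ^∞⟮𝓘(ℝ, H); F, V⟯
  bracket_self : ∀ σ, bracket σ σ = 0
  jacobi : ∀ σ η ζ, bracket σ (bracket η ζ) = bracket (bracket σ η) ζ + bracket η (bracket σ ζ)
  leibniz : ∀ (σ η : Cₛ^∞⟮𝓘(ℝ, H); F, V⟯) (f : C^∞⟮𝓘(ℝ, H), M; ℝ⟯) (x : M),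
    bracket σ (smulSection f η) x =
      f x • bracket σ η x + dirDeriv 𝓘(ℝ, H) f x (anchor x (σ x)) • η x

variable (H F) in
/-- Smoothness of a `p`-form `θ ∈ Sec(⋀ᵖ V*)`: its values on smooth sections are smooth. -/
def IsSmoothForm {p : ℕ} (θ : ∀ x, V x [⋀^Fin p]→ₗ[ℝ] ℝ) : Prop :=
  ∀ σ : Fin p → Cₛ^∞⟮𝓘(ℝ, H); F, V⟯,
    ContMDiff 𝓘(ℝ, H) 𝓘(ℝ, ℝ) ∞ (fun x ↦ θ x (fun i ↦ σ i x))

/-- The vertical vector `b_a^V ∈ T_a E`: the vector tangent to `t ↦ a + t b` at `t = 0`. -/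
def vlift (a : TotalSpace F V) (b : V a.proj) : TangentSpace (𝓘(ℝ, H).prod 𝓘(ℝ, F)) a :=
  mfderiv 𝓘(ℝ, ℝ) (𝓘(ℝ, H).prod 𝓘(ℝ, F))
    (fun t : ℝ ↦ (⟨a.proj, a.2 + t • b⟩ : TotalSpace F V)) 0 (1 : ℝ)

variable (H) in
/-- The pairs `(b, v) ∈ E_m × T_a E`, where `m` is the base point of `a`. The fibre at `a` of the
prolongation is the subspace of those with `ρ(b) = T_a τ(v)`. -/
abbrev Pair (a : TotalSpace F V) : Type _ :=
  V a.proj × TangentSpace (𝓘(ℝ, H).prod 𝓘(ℝ, F)) a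

/-- The vertical lift `ξ^V(a, b) = (a, 0, b_a^V)`. -/
def xiV (a : TotalSpace F V) (b : V a.proj) : Pair H a := (0, vlift a b)

/-- The vertical endomorphism `S(a, b, v) = ξ^V(a, b)`. -/
def vertEndo (a : TotalSpace F V) (z : Pair H a) : Pair H a := xiV a z.1

variable (H) in
/-- The Liouville section `Δ(a) = ξ^V(a, a)`. -/
def liouville (a : TotalSpace F V) : Pair H a := xiV a a.2

/-- The differential `df(a, b, v) = ρ¹(a, b, v) f = v f` of a function on `E`. -/
def prolD (f : TotalSpace F V → ℝ) (a : TotalSpace F V) (z : Pair H a) : ℝ :=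
  dirDeriv (𝓘(ℝ, H).prod 𝓘(ℝ, F)) f a z.2

/-- The Cartan 1-form `θ_L = S^*(dL)`. -/
def cartanOneForm (L : TotalSpace F V → ℝ) (a : TotalSpace F V) (z : Pair H a) : ℝ :=
  prolD L a (vertEndo a z)

variable (H) in
/-- The energy `E_L = d_Δ L - L`. -/
def energy (L : TotalSpace F V → ℝ) (a : TotalSpace F V) : ℝ :=
  prolD L a (liouville H a) - L a

namespace LieAlgebroid

variable (A : LieAlgebroid H F V)

/-- The second sum in the formula for the exterior differential of a `p`-form,
`∑_{i<j} (-1)^{i+j} θ([σ_i, σ_j], σ_0, …, σ̂_i, …, σ̂_j, …, σ_p)`. It is empty for `p = 0`. For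
`p = q + 1` the pairs `i < j` are written `(i.castSucc, j.succ)` with `i ≤ j` in `Fin (q + 1)`. -/
def bracketSum : (p : ℕ) → (∀ x, V x [⋀^Fin p]→ₗ[ℝ] ℝ) →
    (Fin (p + 1) → Cₛ^∞⟮𝓘(ℝ, H); F, V⟯) → M → ℝ
  | 0, _, _, _ => 0
  | q + 1, θ, σ, x => ∑ i : Fin (q + 1), ∑ j ∈ Finset.univ.filter (fun j ↦ i ≤ j),
      (-1 : ℝ) ^ ((i.castSucc : ℕ) + (j.succ : ℕ)) *
        θ x (Matrix.vecCons (A.bracket (σ i.castSucc) (σ j.succ) x)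
          (j.removeNth (i.castSucc.removeNth (fun k ↦ σ k x))))

/-- `η = dθ` for the exterior differential of the Lie algebroid: for all smooth sections,
`η(σ_0, …, σ_p) = ∑_i (-1)^i ρ(σ_i)(θ(σ_0, …, σ̂_i, …, σ_p)) + ∑_{i<j} …`. -/
def IsExtDeriv {p : ℕ} (θ : ∀ x, V x [⋀^Fin p]→ₗ[ℝ] ℝ)
    (η : ∀ x, V x [⋀^Fin (p + 1)]→ₗ[ℝ] ℝ) : Prop :=
  ∀ (σ : Fin (p + 1) → Cₛ^∞⟮𝓘(ℝ, H); F, V⟯) (x : M),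
    η x (fun i ↦ σ i x) =
      ∑ i : Fin (p + 1), (-1 : ℝ) ^ (i : ℕ) *
        dirDeriv 𝓘(ℝ, H) (fun y ↦ θ y (i.removeNth (fun k ↦ σ k y))) x (A.anchor x (σ i x))
      + A.bracketSum p θ σ x

/-- The fibre at `a ∈ E` of the prolongation `T^E E`:
`{(b, v) ∈ E_m × T_a E | ρ(b) = T_a τ(v)}`. -/
def Prol (a : TotalSpace F V) : Submodule ℝ (Pair H a) where
  carrier := {z | A.anchor a.proj z.1 =
    mfderiv (𝓘(ℝ, H).prod 𝓘(ℝ, F)) 𝓘(ℝ, H) (π F V) a z.2}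
  add_mem' {z w} hz hw := by
    simp only [Set.mem_ofPred_eq, Prod.fst_add, Prod.snd_add, map_add] at hz hw ⊢
    rw [hz, hw]
  zero_mem' := by simp
  smul_mem' c z hz := by
    simp only [Set.mem_ofPred_eq, Prod.smul_fst, Prod.smul_snd, map_smul] at hz ⊢
    rw [hz]

/-- A smooth projectable section `Z(a) = (a, σ(τ(a)), X(a))` of the prolongation. -/
structure ProjSection where
  base : Cₛ^∞⟮𝓘(ℝ, H); F, V⟯
  field : ∀ a : TotalSpace F V, TangentSpace (𝓘(ℝ, H).prod 𝓘(ℝ, F)) a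
  contMDiff_field : ContMDiff (𝓘(ℝ, H).prod 𝓘(ℝ, F)) (𝓘(ℝ, H).prod 𝓘(ℝ, F)).tangent ∞
    (fun a ↦ (⟨a, field a⟩ : TangentBundle (𝓘(ℝ, H).prod 𝓘(ℝ, F)) (TotalSpace F V)))
  mem_prol : ∀ a : TotalSpace F V, ((base a.proj, field a) : Pair H a) ∈ A.Prol a

variable {A} in
/-- The value at `a` of a projectable section. -/
def ProjSection.val (Z : A.ProjSection) (a : TotalSpace F V) : A.Prol a :=
  ⟨(Z.base a.proj, Z.field a), Z.mem_prol a⟩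

variable {A} in
/-- The bracket `[Z₁, Z₂](a) = (a, [σ₁, σ₂](τ(a)), [X₁, X₂](a))` of projectable sections. -/
def ProjSection.bracket (Z₁ Z₂ : A.ProjSection) (a : TotalSpace F V) : Pair H a :=
  (A.bracket Z₁.base Z₂.base a.proj,
    VectorField.mlieBracket (𝓘(ℝ, H).prod 𝓘(ℝ, F)) Z₁.field Z₂.field a)

/-- `η = dθ` on the Lie algebroid `T^E E`, for a 1-form `θ` and a 2-form `η`:
`η(Z₁, Z₂) = ρ¹(Z₁)(θ(Z₂)) - ρ¹(Z₂)(θ(Z₁)) - θ([Z₁, Z₂])`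
for all projectable sections. The values of projectable sections exhaust each fibre, so this
determines `η`; only the values of `θ` on `T^E E` matter. -/
def IsProlExtDeriv (θ : ∀ a : TotalSpace F V, Pair H a → ℝ)
    (η : ∀ a : TotalSpace F V, A.Prol a [⋀^Fin 2]→ₗ[ℝ] ℝ) : Prop :=
  ∀ (Z₁ Z₂ : A.ProjSection) (a : TotalSpace F V),
    η a ![Z₁.val a, Z₂.val a] =
      prolD (fun c ↦ θ c (Z₂.val c)) a (Z₁.val a : Pair H a)
      - prolD (fun c ↦ θ c (Z₁.val c)) a (Z₂.val a : Pair H a)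
      - θ a (Z₁.bracket Z₂ a)

open Classical in
/-- The Cartan 2-form `ω_L = -dθ_L`, a 2-form on `T^E E`. (For a smooth `L` the differential
`dθ_L` exists and is unique; the other branch is never taken.) -/
def cartanTwoForm (L : TotalSpace F V → ℝ) (a : TotalSpace F V) :
    A.Prol a [⋀^Fin 2]→ₗ[ℝ] ℝ :=
  if h : ∃ η, A.IsProlExtDeriv (cartanOneForm L) η then -(h.choose a) else 0

/-- `ω_L` is nondegenerate at `a`. -/
def IsRegularAt (L : TotalSpace F V → ℝ) (a : TotalSpace F V) : Prop :=
  ∀ z : A.Prol a, (∀ w : A.Prol a, A.cartanTwoForm L a ![z, w] = 0) → z = 0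

/-- `L` is a regular Lagrangian: `ω_L` is nondegenerate at every point. -/
def IsRegular (L : TotalSpace F V → ℝ) : Prop := ∀ a, A.IsRegularAt L a

/-- `Γ` solves the free dynamics of `L`: `i_Γ ω_L = dE_L`. For a regular `L` this determines `Γ` at
each point, and `Γ` is then automatically smooth and a SODE section (`S Γ = Δ`). -/
def IsFreeDynamics (L : TotalSpace F V → ℝ) (Γ : ∀ a : TotalSpace F V, A.Prol a) : Prop :=
  ∀ (a : TotalSpace F V) (w : A.Prol a),
    A.cartanTwoForm L a ![Γ a, w] = prolD (energy H L) a (w : Pair H a)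

variable {A} in
/-- The vector field `ρ¹(Γ)` on `E`. -/
def prolAnchor (Γ : ∀ a : TotalSpace F V, A.Prol a) (a : TotalSpace F V) :
    TangentSpace (𝓘(ℝ, H).prod 𝓘(ℝ, F)) a :=
  (Γ a : Pair H a).2

end LieAlgebroid

end OneBundle

section TwoBundles

variable {H : Type*} [NormedAddCommGroup H] [NormedSpace ℝ H]
  {M : Type*} [TopologicalSpace M] [ChartedSpace H M] [IsManifold 𝓘(ℝ, H) ∞ M]
  {F : Type*} [NormedAddCommGroup F] [NormedSpace ℝ F]
  {V : M → Type*} [TopologicalSpace (TotalSpace F V)]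
  [∀ x, TopologicalSpace (V x)] [∀ x, AddCommGroup (V x)] [∀ x, Module ℝ (V x)]
  [FiberBundle F V] [VectorBundle ℝ F V] [ContMDiffVectorBundle ∞ F V 𝓘(ℝ, H)]
  {H' : Type*} [NormedAddCommGroup H'] [NormedSpace ℝ H']
  {M' : Type*} [TopologicalSpace M'] [ChartedSpace H' M'] [IsManifold 𝓘(ℝ, H') ∞ M']
  {F' : Type*} [NormedAddCommGroup F'] [NormedSpace ℝ F']
  {V' : M' → Type*} [TopologicalSpace (TotalSpace F' V')]
  [∀ x, TopologicalSpace (V' x)] [∀ x, AddCommGroup (V' x)] [∀ x, Module ℝ (V' x)]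
  [FiberBundle F' V'] [VectorBundle ℝ F' V'] [ContMDiffVectorBundle ∞ F' V' 𝓘(ℝ, H')]

variable (H F V H' F' V') in
/-- A smooth vector bundle map `Φ : E → E'` over a smooth map `φ : M → M'`. -/
structure BundleMap where
  base : M → M'
  fiber : ∀ x, V x →ₗ[ℝ] V' (base x)
  contMDiff_base : ContMDiff 𝓘(ℝ, H) 𝓘(ℝ, H') ∞ base
  contMDiff_total : ContMDiff (𝓘(ℝ, H).prod 𝓘(ℝ, F)) (𝓘(ℝ, H').prod 𝓘(ℝ, F')) ∞
    (fun a : TotalSpace F V ↦ (⟨base a.proj, fiber a.proj a.2⟩ : TotalSpace F' V'))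

namespace BundleMap

variable (Φ : BundleMap H F V H' F' V')

/-- `Φ` as a map between total spaces. -/
def total (a : TotalSpace F V) : TotalSpace F' V' := ⟨Φ.base a.proj, Φ.fiber a.proj a.2⟩

/-- The pullback `(Φ^⋆ β)_m(a_1, …, a_p) = β_{φ(m)}(Φ(a_1), …, Φ(a_p))`. -/
def pullback {p : ℕ} (β : ∀ x, V' x [⋀^Fin p]→ₗ[ℝ] ℝ) (x : M) : V x [⋀^Fin p]→ₗ[ℝ] ℝ :=
  (β (Φ.base x)).compLinearMap (Φ.fiber x)

/-- `Φ` is a morphism of Lie algebroids: `Φ^⋆ dθ = d Φ^⋆ θ` for all forms `θ` on `E'`. -/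
def IsMorphism (A : LieAlgebroid H F V) (A' : LieAlgebroid H' F' V') : Prop :=
  ∀ (p : ℕ) (θ : ∀ x, V' x [⋀^Fin p]→ₗ[ℝ] ℝ) (η : ∀ x, V' x [⋀^Fin (p + 1)]→ₗ[ℝ] ℝ),
    IsSmoothForm H' F' θ → A'.IsExtDeriv θ η → A.IsExtDeriv (Φ.pullback θ) (Φ.pullback η)

/-- The prolongation `T^Φ Φ(a, b, v) = (Φ(a), Φ(b), T_a Φ(v))`. -/
def prolong (a : TotalSpace F V) (z : Pair H a) : Pair H' (Φ.total a) :=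
  (Φ.fiber a.proj z.1,
    mfderiv (𝓘(ℝ, H).prod 𝓘(ℝ, F)) (𝓘(ℝ, H').prod 𝓘(ℝ, F')) Φ.total a z.2)

end BundleMap

end TwoBundles

end LieAlgd

end

/-! The map `T^Φ Φ` is onto on each fibre of the prolongation, pulls `ω_{L'}` back to `ω_L` and
pulls `dE_{L'}` back to `dE_L`. Everything else is linear algebra. A vector in the radical of
`ω_{L'}` at `Φ(a)` lifts to a vector in the radical of `ω_L` at `a`, which is zero. The image of
`Γ_L(a)` satisfies the equation of `Γ_{L'}` at `Φ(a)`, because every test vector there lifts, and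
nondegeneracy forces equality. The chain rule then carries integral curves over.

Surjectivity (`exists_prolong_eq`) does not require `φ` to be a submersion. Once `b'` is lifted, a
lift of the tangent vector is correct up to a vertical error, and vertical vectors lift because `Φ`
is onto on fibres. The energy identity is immediate, since `Φ` is linear on fibres and so respects
vertical lifts.

The substance is the pullback identity for `ω_L` (`cartanTwoForm_prolong`). The form `θ_L` sees only
the component `b`: it is the fibre derivative `p` of `L`, a family of covectors along `τ`. So `dθ_L
= v₁(p(σ₂)) - v₂(p(σ₁)) - p([σ₁, σ₂])`, with no vector fields on `E`; by the Leibniz rule this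
depends only on the values of the `σᵢ` at the point (`extDerivAlong_congr`). Upstairs and
downstairs, extend the vectors to sections `σᵢ` and `ηᵢ` related by `Φ` at the single point
considered; sections related everywhere need not exist. In a frame `e_j` of `V'` with dual
coordinates `e^j`, the difference of the two expressions is a combination of the numbers `p'(e_j)`.
The coefficient of `p'(e_j)` is `d(Φ^⋆ e^j)(σ₁, σ₂) - (de^j)(η₁, η₂)`, which vanishes because `Φ` is
a morphism. Only forms of degree 0 (compatibility with the anchors) and degree 1 are needed. -/

noncomputable section

namespace LieAlgd

set_option linter.unusedSectionVars false

/-! ### Calculus of directional derivatives -/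

section DirDeriv

variable {E : Type*} [NormedAddCommGroup E] [NormedSpace ℝ E]
  {K : Type*} [TopologicalSpace K] {I : ModelWithCorners ℝ E K}
  {N : Type*} [TopologicalSpace N] [ChartedSpace K N]
  {E' : Type*} [NormedAddCommGroup E'] [NormedSpace ℝ E']
  {K' : Type*} [TopologicalSpace K'] {I' : ModelWithCorners ℝ E' K'}
  {N' : Type*} [TopologicalSpace N'] [ChartedSpace K' N']
  {f g : N → ℝ} {x : N}

theorem dirDeriv_map_add (f : N → ℝ) (v w : TangentSpace I x) :
    dirDeriv I f x (v + w) = dirDeriv I f x v + dirDeriv I f x w :=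
  map_add (mfderiv I 𝓘(ℝ, ℝ) f x) v w

theorem dirDeriv_map_smul (f : N → ℝ) (c : ℝ) (v : TangentSpace I x) :
    dirDeriv I f x (c • v) = c * dirDeriv I f x v :=
  map_smul (mfderiv I 𝓘(ℝ, ℝ) f x) c v

theorem dirDeriv_const (c : ℝ) (v : TangentSpace I x) : dirDeriv I (fun _ ↦ c) x v = 0 := by
  simp only [dirDeriv, mfderiv_const]; rfl

theorem dirDeriv_comp {h : N → N'} {k : N' → ℝ} (hk : MDifferentiableAt I' 𝓘(ℝ, ℝ) k (h x))
    (hh : MDifferentiableAt I I' h x) (v : TangentSpace I x) :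
    dirDeriv I (fun y ↦ k (h y)) x v = dirDeriv I' k (h x) (mfderiv I I' h x v) := by
  have := mfderiv_comp x hk hh
  simp only [dirDeriv]
  exact congrArg (fun l : TangentSpace I x →L[ℝ] ℝ ↦ l v) this

theorem dirDeriv_add (hf : MDifferentiableAt I 𝓘(ℝ, ℝ) f x)
    (hg : MDifferentiableAt I 𝓘(ℝ, ℝ) g x) (v : TangentSpace I x) :
    dirDeriv I (fun y ↦ f y + g y) x v = dirDeriv I f x v + dirDeriv I g x v :=
  congrArg (fun l : TangentSpace I x →L[ℝ] ℝ ↦ l v)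
    (hf.hasMFDerivAt.add hg.hasMFDerivAt).mfderiv

theorem dirDeriv_sub (hf : MDifferentiableAt I 𝓘(ℝ, ℝ) f x)
    (hg : MDifferentiableAt I 𝓘(ℝ, ℝ) g x) (v : TangentSpace I x) :
    dirDeriv I (fun y ↦ f y - g y) x v = dirDeriv I f x v - dirDeriv I g x v :=
  congrArg (fun l : TangentSpace I x →L[ℝ] ℝ ↦ l v)
    (hf.hasMFDerivAt.sub hg.hasMFDerivAt).mfderiv

theorem dirDeriv_mul (hf : MDifferentiableAt I 𝓘(ℝ, ℝ) f x)
    (hg : MDifferentiableAt I 𝓘(ℝ, ℝ) g x) (v : TangentSpace I x) :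
    dirDeriv I (fun y ↦ f y * g y) x v = f x * dirDeriv I g x v + g x * dirDeriv I f x v :=
  congrArg (fun l : TangentSpace I x →L[ℝ] ℝ ↦ l v)
    (hf.hasMFDerivAt.mul hg.hasMFDerivAt).mfderiv

theorem dirDeriv_const_mul (c : ℝ) (hg : MDifferentiableAt I 𝓘(ℝ, ℝ) g x)
    (v : TangentSpace I x) :
    dirDeriv I (fun y ↦ c * g y) x v = c * dirDeriv I g x v := by
  rw [dirDeriv_mul mdifferentiableAt_const hg, dirDeriv_const, mul_zero, add_zero]

theorem mdifferentiableAt_finsetSum {ι : Type*} (s : Finset ι) {f : ι → N → ℝ}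
    (hf : ∀ i ∈ s, MDifferentiableAt I 𝓘(ℝ, ℝ) (f i) x) :
    MDifferentiableAt I 𝓘(ℝ, ℝ) (fun y ↦ ∑ i ∈ s, f i y) x := by
  classical
  induction s using Finset.induction_on with
  | empty => simpa using mdifferentiableAt_const
  | insert i s hi ih =>
    simp only [Finset.sum_insert hi]
    exact (hf i (by simp)).add (ih fun j hj ↦ hf j (by simp [hj]))

theorem dirDeriv_sum {ι : Type*} (s : Finset ι) {f : ι → N → ℝ}
    (hf : ∀ i ∈ s, MDifferentiableAt I 𝓘(ℝ, ℝ) (f i) x) (v : TangentSpace I x) :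
    dirDeriv I (fun y ↦ ∑ i ∈ s, f i y) x v = ∑ i ∈ s, dirDeriv I (f i) x v := by
  classical
  induction s using Finset.induction_on with
  | empty => simpa using dirDeriv_const 0 v
  | insert i s hi ih =>
    simp only [Finset.sum_insert hi]
    rw [dirDeriv_add (hf i (by simp))
      (mdifferentiableAt_finsetSum s fun j hj ↦ hf j (by simp [hj])),
      ih fun j hj ↦ hf j (by simp [hj])]

end DirDeriv

/-! ### Global frames adapted to a point -/

section Frame

variable {H : Type*} [NormedAddCommGroup H] [NormedSpace ℝ H]
  {M : Type*} [TopologicalSpace M] [ChartedSpace H M] [IsManifold 𝓘(ℝ, H) ∞ M]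
  {F : Type*} [NormedAddCommGroup F] [NormedSpace ℝ F]
  {V : M → Type*} [TopologicalSpace (TotalSpace F V)]
  [∀ x, TopologicalSpace (V x)] [∀ x, AddCommGroup (V x)] [∀ x, Module ℝ (V x)]
  [FiberBundle F V] [VectorBundle ℝ F V] [ContMDiffVectorBundle ∞ F V 𝓘(ℝ, H)]

theorem exists_bump [FiniteDimensional ℝ H] [T2Space M] {m : M} {s : Set M} (hs : s ∈ nhds m) :
    ∃ χ : C^∞⟮𝓘(ℝ, H), M; ℝ⟯, χ m = 1 ∧ tsupport χ ⊆ s := by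
  obtain ⟨χ, -, hχ⟩ := (SmoothBumpFunction.nhds_basis_tsupport (I := 𝓘(ℝ, H)) m).mem_iff.1 hs
  exact ⟨⟨χ, χ.contMDiff⟩, χ.eq_one, hχ⟩

theorem contMDiff_bump_smul_section {U : Set M} (hU : IsOpen U) (χ : C^∞⟮𝓘(ℝ, H), M; ℝ⟯)
    (hχ : tsupport χ ⊆ U) {s : ∀ x, V x}
    (hs : ContMDiffOn 𝓘(ℝ, H) (𝓘(ℝ, H).prod 𝓘(ℝ, F)) ∞ (fun x ↦ (⟨x, s x⟩ : TotalSpace F V)) U) :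
    ContMDiff 𝓘(ℝ, H) (𝓘(ℝ, H).prod 𝓘(ℝ, F)) ∞
      (fun x ↦ (⟨x, χ x • s x⟩ : TotalSpace F V)) :=
  ContMDiffOn.smul_section_of_tsupport χ.contMDiff.contMDiffOn hU hχ hs

variable (H F V) in
/-- A finite family of smooth sections and of fibrewise linear smooth functions on `V` which are
dual frames at `m`: at every point they compose to multiplication by a smooth function which is
`1` at `m`. -/
structure FrameAt (m : M) where
  n : ℕ
  sec : Fin n → Cₛ^∞⟮𝓘(ℝ, H); F, V⟯
  coord : Fin n → ∀ x, V x →ₗ[ℝ] ℝ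
  cutoff : C^∞⟮𝓘(ℝ, H), M; ℝ⟯
  cutoff_self : cutoff m = 1
  contMDiff_coord : ∀ j, ContMDiff (𝓘(ℝ, H).prod 𝓘(ℝ, F)) 𝓘(ℝ, ℝ) ∞
    (fun a : TotalSpace F V ↦ coord j a.proj a.2)
  sum_coord : ∀ x (b : V x), ∑ j, coord j x b • sec j x = cutoff x • b

theorem FrameAt.exists [FiniteDimensional ℝ H] [T2Space M] [FiniteDimensional ℝ F] (m : M) :
    Nonempty (FrameAt H F V m) := by
  let t := trivializationAt F V m
  let B := Module.finBasis ℝ F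
  obtain ⟨χ, hχ, hsupp⟩ := exists_bump (H := H) (t.open_baseSet.mem_nhds
    (mem_baseSet_trivializationAt F V m))
  have hzero : ∀ x, x ∉ t.baseSet → χ x = 0 := fun x hx ↦
    image_eq_zero_of_notMem_tsupport fun h ↦ hx (hsupp h)
  refine ⟨{
    n := Module.finrank ℝ F
    sec := fun j ↦ ⟨fun x ↦ χ x • t.symm x (B j), ?_⟩
    coord := fun j x ↦ χ x • (B.coord j ∘ₗ t.linearMapAt ℝ x)
    -- The sections and the coordinates each carry one factor `χ`, so that both are globally smooth.
    cutoff := χ * χ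
    cutoff_self := by simp [hχ]
    contMDiff_coord := fun j ↦ ?_
    sum_coord := fun x b ↦ ?_ }⟩
  · refine contMDiff_bump_smul_section t.open_baseSet χ hsupp ?_
    rw [t.contMDiffOn_section_baseSet_iff]
    refine (contMDiffOn_const (c := B j)).congr fun x hx ↦ ?_
    exact congrArg Prod.snd (t.apply_mk_symm hx (B j))
  -- Smoothness is checked on two open sets covering the total space: the domain of the
  -- trivialization, and the part over the complement of the support of `χ`, where the coordinate is
  -- zero.
  · refine contMDiff_of_contMDiffOn_union_of_isOpen (s := t.source)
      (t := (π F V ⁻¹' (tsupport χ))ᶜ) ?_ ?_ ?_ t.open_source ?_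
    · have h1 : ContMDiffOn (𝓘(ℝ, H).prod 𝓘(ℝ, F)) 𝓘(ℝ, F) ∞ (fun a ↦ (t a).2) t.source :=
        contMDiff_snd.comp_contMDiffOn t.contMDiffOn
      have h2 : ContMDiff (𝓘(ℝ, H).prod 𝓘(ℝ, F)) 𝓘(ℝ, ℝ) ∞
          (fun a : TotalSpace F V ↦ χ a.proj) := χ.contMDiff.comp (contMDiff_proj V)
      have h3 : ContMDiff 𝓘(ℝ, F) 𝓘(ℝ, ℝ) ∞ (LinearMap.toContinuousLinearMap (B.coord j)) :=
        (LinearMap.toContinuousLinearMap (B.coord j)).contMDiff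
      refine (h2.contMDiffOn.mul (h3.comp_contMDiffOn h1)).congr fun a ha ↦ ?_
      simp [t.coe_linearMapAt_of_mem (t.mem_source.1 ha)]
    · refine (contMDiffOn_const (c := (0 : ℝ))).congr fun a ha ↦ ?_
      have : χ a.proj = 0 := image_eq_zero_of_notMem_tsupport ha
      simp [this]
    · ext a
      simp only [Set.mem_union, Set.mem_compl_iff, Set.mem_preimage, Set.mem_univ, iff_true]
      by_cases h : a.proj ∈ tsupport χ
      · exact Or.inl (t.mem_source.2 (hsupp h))
      · exact Or.inr h
    · exact ((isClosed_tsupport χ).preimage (FiberBundle.continuous_proj F V)).isOpen_compl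
  · by_cases hx : x ∈ t.baseSet
    · have : ∑ j, B.coord j (t.linearMapAt ℝ x b) • t.symm x (B j) = b := by
        have h := congrArg (t.symmₗ ℝ x) (B.sum_repr (t.linearMapAt ℝ x b))
        rw [map_sum, t.symmₗ_linearMapAt hx] at h
        simp only [map_smul] at h
        simp only [t.symmₗ_apply hx] at h
        exact h
      conv_rhs => rw [← this, Finset.smul_sum]
      refine Finset.sum_congr rfl fun j _ ↦ ?_
      change (χ x * B.coord j (t.linearMapAt ℝ x b)) • χ x • t.symm x (B j) =
        (χ x * χ x) • B.coord j (t.linearMapAt ℝ x b) • t.symm x (B j)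
      rw [smul_smul, smul_smul, mul_right_comm]
    · simp [hzero x hx]

end Frame

/-! ### Covectors along a map and tensoriality of the exterior derivative -/

section Along

variable {H : Type*} [NormedAddCommGroup H] [NormedSpace ℝ H]
  {M : Type*} [TopologicalSpace M] [ChartedSpace H M] [IsManifold 𝓘(ℝ, H) ∞ M]
  {F : Type*} [NormedAddCommGroup F] [NormedSpace ℝ F]
  {V : M → Type*} [TopologicalSpace (TotalSpace F V)]
  [∀ x, TopologicalSpace (V x)] [∀ x, AddCommGroup (V x)] [∀ x, Module ℝ (V x)]
  [FiberBundle F V] [VectorBundle ℝ F V] [ContMDiffVectorBundle ∞ F V 𝓘(ℝ, H)]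
  {E : Type*} [NormedAddCommGroup E] [NormedSpace ℝ E]
  {K : Type*} [TopologicalSpace K] {I : ModelWithCorners ℝ E K}
  {N : Type*} [TopologicalSpace N] [ChartedSpace K N]

theorem smooth_section_sum {ι : Type*} (s : Finset ι) (σ : ι → Cₛ^∞⟮𝓘(ℝ, H); F, V⟯) (x : M) :
    (∑ i ∈ s, σ i) x = ∑ i ∈ s, σ i x := by
  have := congrFun (map_sum (ContMDiffSection.coeAddHom 𝓘(ℝ, H) F ∞ V) σ s) x
  rw [Finset.sum_apply] at this
  exact this

namespace FrameAt

variable {m : M} (fr : FrameAt H F V m)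

/-- The components of a smooth section in a frame. -/
def component (σ : Cₛ^∞⟮𝓘(ℝ, H); F, V⟯) (j : Fin fr.n) : C^∞⟮𝓘(ℝ, H), M; ℝ⟯ :=
  ⟨fun x ↦ fr.coord j x (σ x), (fr.contMDiff_coord j).comp σ.contMDiff⟩

theorem cutoff_smulSection (σ : Cₛ^∞⟮𝓘(ℝ, H); F, V⟯) :
    smulSection fr.cutoff σ = ∑ j, smulSection (fr.component σ j) (fr.sec j) := by
  ext x
  rw [smooth_section_sum]
  exact (fr.sum_coord x (σ x)).symm

theorem mdifferentiableAt_coord {G : N → M} {s : ∀ c, V (G c)} {n : N}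
    (hs : MDifferentiableAt I (𝓘(ℝ, H).prod 𝓘(ℝ, F)) (fun c ↦ (⟨G c, s c⟩ : TotalSpace F V)) n)
    (j : Fin fr.n) : MDifferentiableAt I 𝓘(ℝ, ℝ) (fun c ↦ fr.coord j (G c) (s c)) n :=
  MDifferentiableAt.comp n (f := fun c ↦ (⟨G c, s c⟩ : TotalSpace F V))
    (g := fun a : TotalSpace F V ↦ fr.coord j a.proj a.2)
    ((fr.contMDiff_coord j).mdifferentiable (by simp) _) hs

/-- Linear extension of vectors at `m` to smooth sections. -/
def extend : V m →ₗ[ℝ] Cₛ^∞⟮𝓘(ℝ, H); F, V⟯ :=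
  ∑ j, (fr.coord j m).smulRight (fr.sec j)

theorem extend_self (b : V m) : fr.extend b m = b := by
  have : fr.extend b = ∑ j, fr.coord j m b • fr.sec j := by simp [extend]
  rw [this, smooth_section_sum]
  have h := fr.sum_coord m b
  rw [fr.cutoff_self, one_smul] at h
  exact h

end FrameAt

/-- Derivative of a pairing whose second factor vanishes at the point. -/
theorem dirDeriv_pairing {G : N → M} {n : N} (fr : FrameAt H F V (G n))
    {lam : ∀ c, V (G c) →ₗ[ℝ] ℝ} {s : ∀ c, V (G c)}
    (hs : MDifferentiableAt I (𝓘(ℝ, H).prod 𝓘(ℝ, F)) (fun c ↦ (⟨G c, s c⟩ : TotalSpace F V)) n)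
    (h0 : s n = 0)
    (hlam : ∀ j, MDifferentiableAt I 𝓘(ℝ, ℝ) (fun c ↦ lam c (fr.sec j (G c))) n)
    (hls : MDifferentiableAt I 𝓘(ℝ, ℝ) (fun c ↦ lam c (s c)) n) (v : TangentSpace I n) :
    dirDeriv I (fun c ↦ lam c (s c)) n v =
      ∑ j, dirDeriv I (fun c ↦ fr.coord j (G c) (s c)) n v * lam n (fr.sec j (G n)) := by
  have hG : MDifferentiableAt I 𝓘(ℝ, H) G n :=
    MDifferentiableAt.comp n (f := fun c ↦ (⟨G c, s c⟩ : TotalSpace F V)) (g := π F V)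
      ((contMDiff_proj V (n := ∞)).mdifferentiable (by simp) _) hs
  have hcut : MDifferentiableAt I 𝓘(ℝ, ℝ) (fun c ↦ fr.cutoff (G c)) n :=
    MDifferentiableAt.comp n (f := G) (fr.cutoff.contMDiff.mdifferentiable (by simp) _) hG
  -- The frame expansion of `s` holds at every point only after multiplication by the cutoff. At `n`
  -- this is harmless: the cutoff is `1` and its derivative is multiplied by `lam n (s n) = 0`.
  have h1 : (fun c ↦ fr.cutoff (G c) * lam c (s c)) =
      fun c ↦ ∑ j, fr.coord j (G c) (s c) * lam c (fr.sec j (G c)) := by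
    ext c
    rw [← smul_eq_mul, ← map_smul, ← fr.sum_coord, map_sum]
    simp
  have h2 := dirDeriv_mul hcut hls v
  rw [h1, dirDeriv_sum (f := fun j c ↦ fr.coord j (G c) (s c) * lam c (fr.sec j (G c))) _
      fun j _ ↦ (fr.mdifferentiableAt_coord hs j).mul (hlam j),
    fr.cutoff_self, h0, map_zero, one_mul, zero_mul, add_zero] at h2
  rw [← h2]
  refine Finset.sum_congr rfl fun j _ ↦ ?_
  rw [dirDeriv_mul (fr.mdifferentiableAt_coord hs j) (hlam j), h0, map_zero, zero_mul, zero_add,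
    mul_comm]

variable (H F I) in
/-- A family of covectors along `G` is differentiable at `n` if its values on smooth sections are. -/
def DiffCovector {G : N → M} (lam : ∀ c, V (G c) →ₗ[ℝ] ℝ) (n : N) : Prop :=
  ∀ σ : Cₛ^∞⟮𝓘(ℝ, H); F, V⟯, MDifferentiableAt I 𝓘(ℝ, ℝ) (fun c ↦ lam c (σ (G c))) n

namespace LieAlgebroid

variable (A : LieAlgebroid H F V)

/-- Multiplying `δ` by the cutoff does not change the bracket at `m`: the derivative term of the
Leibniz rule contains `δ m = 0`. The product expands globally in the frame, and a second use of the
Leibniz rule leaves only derivatives of the components. -/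
theorem bracket_of_eq_zero {m : M} (fr : FrameAt H F V m) (σ δ : Cₛ^∞⟮𝓘(ℝ, H); F, V⟯)
    (h0 : δ m = 0) :
    A.bracket σ δ m =
      ∑ j, dirDeriv 𝓘(ℝ, H) (fr.component δ j) m (A.anchor m (σ m)) • fr.sec j m := by
  have h1 := A.leibniz σ δ fr.cutoff m
  rw [fr.cutoff_smulSection, h0, smul_zero, add_zero, fr.cutoff_self, one_smul, map_sum,
    smooth_section_sum] at h1
  rw [← h1]
  refine Finset.sum_congr rfl fun j _ ↦ ?_
  have : fr.component δ j m = 0 := by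
    change fr.coord j m (δ m) = 0
    rw [h0, map_zero]
  rw [A.leibniz, this, zero_smul, zero_add]

theorem bracket_antisymm (σ η : Cₛ^∞⟮𝓘(ℝ, H); F, V⟯) : A.bracket σ η = -A.bracket η σ := by
  have h := A.bracket_self (σ + η)
  simp only [map_add, LinearMap.add_apply, A.bracket_self, zero_add, add_zero] at h
  exact eq_neg_of_add_eq_zero_right h

/-- The cancellation behind tensoriality. Both sides equal the sum over the frame of the derivatives
of the components of `δ` times `lam n` of the frame sections; the anchor condition on `v` matches
these derivatives. -/
theorem dirDeriv_covector_of_eq_zero {G : N → M} {n : N} (fr : FrameAt H F V (G n))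
    (hG : MDifferentiableAt I 𝓘(ℝ, H) G n)
    {lam : ∀ c, V (G c) →ₗ[ℝ] ℝ} (hlam : DiffCovector H F I lam n)
    (σ δ : Cₛ^∞⟮𝓘(ℝ, H); F, V⟯) (h0 : δ (G n) = 0) {v : TangentSpace I n}
    (hv : A.anchor (G n) (σ (G n)) = mfderiv I 𝓘(ℝ, H) G n v) :
    dirDeriv I (fun c ↦ lam c (δ (G c))) n v = lam n (A.bracket σ δ (G n)) := by
  have hs : MDifferentiableAt I (𝓘(ℝ, H).prod 𝓘(ℝ, F))
      (fun c ↦ (⟨G c, δ (G c)⟩ : TotalSpace F V)) n :=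
    MDifferentiableAt.comp n (f := G) (g := fun x ↦ (⟨x, δ x⟩ : TotalSpace F V))
      (δ.contMDiff.mdifferentiable (by simp) _) hG
  rw [dirDeriv_pairing fr hs h0 (fun j ↦ hlam _) (hlam δ), A.bracket_of_eq_zero fr σ δ h0, map_sum]
  refine Finset.sum_congr rfl fun j _ ↦ ?_
  rw [map_smul, smul_eq_mul, hv]
  congr 1
  exact dirDeriv_comp (k := fr.component δ j)
    ((fr.component δ j).contMDiff.mdifferentiable (by simp) _) hG v

/-- The expression `v₁(λ(σ₂)) - v₂(λ(σ₁)) - λ([σ₁, σ₂])` for a family `λ` of covectors along a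
map. -/
def extDerivAlong {G : N → M} (lam : ∀ c, V (G c) →ₗ[ℝ] ℝ) (n : N)
    (σ₁ σ₂ : Cₛ^∞⟮𝓘(ℝ, H); F, V⟯) (v₁ v₂ : TangentSpace I n) : ℝ :=
  dirDeriv I (fun c ↦ lam c (σ₂ (G c))) n v₁ - dirDeriv I (fun c ↦ lam c (σ₁ (G c))) n v₂
    - lam n (A.bracket σ₁ σ₂ (G n))

theorem extDerivAlong_def {G : N → M} (lam : ∀ c, V (G c) →ₗ[ℝ] ℝ) (n : N)
    (σ₁ σ₂ : Cₛ^∞⟮𝓘(ℝ, H); F, V⟯) (v₁ v₂ : TangentSpace I n) :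
    A.extDerivAlong lam n σ₁ σ₂ v₁ v₂ = dirDeriv I (fun c ↦ lam c (σ₂ (G c))) n v₁ -
      dirDeriv I (fun c ↦ lam c (σ₁ (G c))) n v₂ - lam n (A.bracket σ₁ σ₂ (G n)) := rfl

theorem extDerivAlong_swap {G : N → M} (lam : ∀ c, V (G c) →ₗ[ℝ] ℝ) (n : N)
    (σ₁ σ₂ : Cₛ^∞⟮𝓘(ℝ, H); F, V⟯) (v₁ v₂ : TangentSpace I n) :
    A.extDerivAlong lam n σ₁ σ₂ v₁ v₂ = -A.extDerivAlong lam n σ₂ σ₁ v₂ v₁ := by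
  have : lam n (A.bracket σ₁ σ₂ (G n)) = -lam n (A.bracket σ₂ σ₁ (G n)) := by
    rw [A.bracket_antisymm σ₁ σ₂, ContMDiffSection.coe_neg, Pi.neg_apply, map_neg]
  simp only [extDerivAlong, this]
  ring

theorem extDerivAlong_congr_right {G : N → M} {n : N} (fr : FrameAt H F V (G n))
    (hG : MDifferentiableAt I 𝓘(ℝ, H) G n)
    {lam : ∀ c, V (G c) →ₗ[ℝ] ℝ} (hlam : DiffCovector H F I lam n)
    {σ₁ σ₂ η₂ : Cₛ^∞⟮𝓘(ℝ, H); F, V⟯} {v₁ v₂ : TangentSpace I n}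
    (hv : A.anchor (G n) (σ₁ (G n)) = mfderiv I 𝓘(ℝ, H) G n v₁) (h : σ₂ (G n) = η₂ (G n)) :
    A.extDerivAlong lam n σ₁ σ₂ v₁ v₂ = A.extDerivAlong lam n σ₁ η₂ v₁ v₂ := by
  have h1 := A.dirDeriv_covector_of_eq_zero fr hG hlam σ₁ (σ₂ - η₂)
    (by rw [ContMDiffSection.coe_sub, Pi.sub_apply, h, sub_self]) hv
  have h2 : (fun c ↦ lam c ((σ₂ - η₂) (G c))) =
      fun c ↦ lam c (σ₂ (G c)) - lam c (η₂ (G c)) := by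
    ext c; rw [ContMDiffSection.coe_sub, Pi.sub_apply, map_sub]
  rw [h2, dirDeriv_sub (hlam _) (hlam _), map_sub, ContMDiffSection.coe_sub, Pi.sub_apply,
    map_sub] at h1
  simp only [extDerivAlong]
  linarith

theorem extDerivAlong_congr {G : N → M} {n : N} (fr : FrameAt H F V (G n))
    (hG : MDifferentiableAt I 𝓘(ℝ, H) G n)
    {lam : ∀ c, V (G c) →ₗ[ℝ] ℝ} (hlam : DiffCovector H F I lam n)
    {σ₁ σ₂ η₁ η₂ : Cₛ^∞⟮𝓘(ℝ, H); F, V⟯} {v₁ v₂ : TangentSpace I n}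
    (hv₁ : A.anchor (G n) (σ₁ (G n)) = mfderiv I 𝓘(ℝ, H) G n v₁)
    (hv₂ : A.anchor (G n) (σ₂ (G n)) = mfderiv I 𝓘(ℝ, H) G n v₂)
    (h₁ : σ₁ (G n) = η₁ (G n)) (h₂ : σ₂ (G n) = η₂ (G n)) :
    A.extDerivAlong lam n σ₁ σ₂ v₁ v₂ = A.extDerivAlong lam n η₁ η₂ v₁ v₂ := by
  -- Antisymmetry reduces a change in the first slot to a change in the second.
  rw [A.extDerivAlong_congr_right fr hG hlam hv₁ h₂, A.extDerivAlong_swap,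
    A.extDerivAlong_congr_right fr hG hlam (h₂ ▸ hv₂) h₁, ← A.extDerivAlong_swap]

/-- The 2-form obtained from `extDerivAlong` by extending vectors to sections linearly. -/
def extDerivForm {G : N → M} {n : N} (fr : FrameAt H F V (G n))
    {lam : ∀ c, V (G c) →ₗ[ℝ] ℝ} (hlam : DiffCovector H F I lam n)
    {W : Type*} [AddCommGroup W] [Module ℝ W] (p : W →ₗ[ℝ] V (G n))
    (q : W →ₗ[ℝ] TangentSpace I n) : W [⋀^Fin 2]→ₗ[ℝ] ℝ :=
  let B : W →ₗ[ℝ] W →ₗ[ℝ] ℝ := LinearMap.mk₂ ℝ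
    (fun w₁ w₂ ↦ A.extDerivAlong lam n (fr.extend (p w₁)) (fr.extend (p w₂)) (q w₁) (q w₂))
    (fun w₁ w₂ w ↦ by
      simp only [extDerivAlong, map_add, LinearMap.add_apply, ContMDiffSection.coe_add,
        Pi.add_apply, dirDeriv_map_add]
      rw [dirDeriv_add (hlam _) (hlam _)]
      ring)
    (fun c w₁ w ↦ by
      simp only [extDerivAlong, map_smul, LinearMap.smul_apply, ContMDiffSection.coe_smul,
        Pi.smul_apply, dirDeriv_map_smul, smul_eq_mul]
      rw [dirDeriv_const_mul c (hlam _)]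
      ring)
    (fun w w₁ w₂ ↦ by
      simp only [extDerivAlong, map_add, ContMDiffSection.coe_add,
        Pi.add_apply, dirDeriv_map_add]
      rw [dirDeriv_add (hlam _) (hlam _)]
      ring)
    (fun c w w₁ ↦ by
      simp only [extDerivAlong, map_smul, ContMDiffSection.coe_smul,
        Pi.smul_apply, dirDeriv_map_smul, smul_eq_mul]
      rw [dirDeriv_const_mul c (hlam _)]
      ring)
  { toFun := fun w ↦ B (w 0) (w 1)
    map_update_add' := fun w i x y ↦ by fin_cases i <;> simp
    map_update_smul' := fun w i c x ↦ by fin_cases i <;> simp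
    map_eq_zero_of_eq' := fun w i j hw hij ↦ by
      have h : w 0 = w 1 := by fin_cases i <;> fin_cases j <;> simp_all
      simp only [B, LinearMap.mk₂_apply, h, extDerivAlong, A.bracket_self]
      simp }

theorem extDerivForm_apply {G : N → M} {n : N} (fr : FrameAt H F V (G n))
    {lam : ∀ c, V (G c) →ₗ[ℝ] ℝ} (hlam : DiffCovector H F I lam n)
    {W : Type*} [AddCommGroup W] [Module ℝ W] (p : W →ₗ[ℝ] V (G n))
    (q : W →ₗ[ℝ] TangentSpace I n) (w : Fin 2 → W) :
    A.extDerivForm fr hlam p q w = A.extDerivAlong lam n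
      (fr.extend (p (w 0))) (fr.extend (p (w 1))) (q (w 0)) (q (w 1)) := rfl

end LieAlgebroid

end Along

/-! ### Vertical lifts and the tangent bundle of the total space -/

section Vertical

variable {H : Type*} [NormedAddCommGroup H] [NormedSpace ℝ H]
  {M : Type*} [TopologicalSpace M] [ChartedSpace H M] [IsManifold 𝓘(ℝ, H) ∞ M]
  {F : Type*} [NormedAddCommGroup F] [NormedSpace ℝ F]
  {V : M → Type*} [TopologicalSpace (TotalSpace F V)]
  [∀ x, TopologicalSpace (V x)] [∀ x, AddCommGroup (V x)] [∀ x, Module ℝ (V x)]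
  [FiberBundle F V] [VectorBundle ℝ F V] [ContMDiffVectorBundle ∞ F V 𝓘(ℝ, H)]
  {E : Type*} [NormedAddCommGroup E] [NormedSpace ℝ E]
  {K : Type*} [TopologicalSpace K] {I : ModelWithCorners ℝ E K}
  {N : Type*} [TopologicalSpace N] [ChartedSpace K N]

theorem contMDiff_add_smul {G : N → M} {s b : ∀ c, V (G c)} {f : N → ℝ}
    (hs : ContMDiff I (𝓘(ℝ, H).prod 𝓘(ℝ, F)) ∞ (fun c ↦ (⟨G c, s c⟩ : TotalSpace F V)))
    (hb : ContMDiff I (𝓘(ℝ, H).prod 𝓘(ℝ, F)) ∞ (fun c ↦ (⟨G c, b c⟩ : TotalSpace F V)))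
    (hf : ContMDiff I 𝓘(ℝ, ℝ) ∞ f) :
    ContMDiff I (𝓘(ℝ, H).prod 𝓘(ℝ, F)) ∞
      (fun c ↦ (⟨G c, s c + f c • b c⟩ : TotalSpace F V)) := by
  intro c
  let t := trivializationAt F V (G c)
  have hc : G c ∈ t.baseSet := mem_baseSet_trivializationAt F V (G c)
  have hs' := (t.contMDiffAt_iff (f := fun c ↦ (⟨G c, s c⟩ : TotalSpace F V))
    (t.mem_source.2 hc)).1 (hs c)
  have hb' := (t.contMDiffAt_iff (f := fun c ↦ (⟨G c, b c⟩ : TotalSpace F V))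
    (t.mem_source.2 hc)).1 (hb c)
  refine (t.contMDiffAt_iff (t.mem_source.2 hc)).2 ⟨hs'.1, ?_⟩
  refine (hs'.2.add ((hf c).smul hb'.2)).congr_of_eventuallyEq ?_
  filter_upwards [hs'.1.continuousAt.preimage_mem_nhds (t.open_baseSet.mem_nhds hc)] with x hx
  have h := t.linearMapAt_apply (R := ℝ) (b := G x)
  have hx' : G x ∈ t.baseSet := hx
  simp only [hx', if_true] at h
  change (t _).2 = (t _).2 + f x • (t _).2
  rw [← h, ← h, ← h, map_add, map_smul]

/-- The curve `t ↦ a + t b` in a fibre. -/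
def fiberLine (a : TotalSpace F V) (b : V a.proj) (t : ℝ) : TotalSpace F V :=
  ⟨a.proj, a.2 + t • b⟩

theorem fiberLine_zero (a : TotalSpace F V) (b : V a.proj) : fiberLine a b 0 = a := by
  simp [fiberLine]

theorem contMDiff_fiberLine (a : TotalSpace F V) (b : V a.proj) :
    ContMDiff 𝓘(ℝ, ℝ) (𝓘(ℝ, H).prod 𝓘(ℝ, F)) ∞ (fiberLine a b) :=
  contMDiff_add_smul (G := fun _ : ℝ ↦ a.proj) (s := fun _ ↦ a.2) (b := fun _ ↦ b) (f := id)
    contMDiff_const contMDiff_const contMDiff_id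

theorem mfderiv_vlift {L : TotalSpace F V → N} {a : TotalSpace F V}
    (hL : MDifferentiableAt (𝓘(ℝ, H).prod 𝓘(ℝ, F)) I L a) (b : V a.proj) :
    mfderiv (𝓘(ℝ, H).prod 𝓘(ℝ, F)) I L a (vlift a b) =
      mfderiv 𝓘(ℝ, ℝ) I (fun t ↦ L (fiberLine a b t)) 0 (1 : ℝ) :=
  (mfderiv_comp_apply_of_eq (g := L) (f := fiberLine a b) (x := (0 : ℝ)) hL
    ((contMDiff_fiberLine a b).mdifferentiable (by simp) _) (fiberLine_zero a b) (1 : ℝ)).symm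

theorem dirDeriv_vlift {L : TotalSpace F V → ℝ} {a : TotalSpace F V}
    (hL : MDifferentiableAt (𝓘(ℝ, H).prod 𝓘(ℝ, F)) 𝓘(ℝ, ℝ) L a) (b : V a.proj) :
    dirDeriv (𝓘(ℝ, H).prod 𝓘(ℝ, F)) L a (vlift a b) =
      dirDeriv 𝓘(ℝ, ℝ) (fun t ↦ L (fiberLine a b t)) (0 : ℝ) (1 : ℝ) :=
  mfderiv_vlift hL b

/-- The value is the `t`-derivative at `0` of `L (a + t s(a))`, a jointly smooth function of `(a,
t)`, and the derivative of a smooth family depends smoothly on the parameter. -/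
theorem contMDiff_dirDeriv_vlift {L : TotalSpace F V → ℝ}
    (hL : ContMDiff (𝓘(ℝ, H).prod 𝓘(ℝ, F)) 𝓘(ℝ, ℝ) ∞ L) {s : ∀ a : TotalSpace F V, V a.proj}
    (hs : ContMDiff (𝓘(ℝ, H).prod 𝓘(ℝ, F)) (𝓘(ℝ, H).prod 𝓘(ℝ, F)) ∞
      (fun a ↦ (⟨a.proj, s a⟩ : TotalSpace F V))) :
    ContMDiff (𝓘(ℝ, H).prod 𝓘(ℝ, F)) 𝓘(ℝ, ℝ) ∞
      (fun a ↦ dirDeriv (𝓘(ℝ, H).prod 𝓘(ℝ, F)) L a (vlift a (s a))) := by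
  have hl : ContMDiff ((𝓘(ℝ, H).prod 𝓘(ℝ, F)).prod 𝓘(ℝ, ℝ)) 𝓘(ℝ, ℝ) ∞
      (Function.uncurry fun (a : TotalSpace F V) (t : ℝ) ↦ L (fiberLine a (s a) t)) :=
    hL.comp (contMDiff_add_smul (G := fun p : TotalSpace F V × ℝ ↦ p.1.proj)
      (s := fun p ↦ p.1.2) (b := fun p ↦ s p.1) (f := fun p ↦ p.2)
      contMDiff_fst (hs.comp contMDiff_fst) contMDiff_snd)
  intro a
  have h := ContMDiffAt.mfderiv (m := ∞) (x₀ := a)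
    (fun (a : TotalSpace F V) (t : ℝ) ↦ L (fiberLine a (s a) t)) (fun _ ↦ 0) (hl _)
    contMDiffAt_const (by simp)
  -- Source and target of the inner map are vector spaces, so the tangent coordinate changes are
  -- trivial.
  have e := inTangentCoordinates_model_space (I := 𝓘(ℝ, ℝ)) (I' := 𝓘(ℝ, ℝ)) (fun _ ↦ (0 : ℝ))
    (fun x : TotalSpace F V ↦ L (fiberLine x (s x) 0))
    (fun x ↦ mfderiv 𝓘(ℝ, ℝ) 𝓘(ℝ, ℝ) (fun t ↦ L (fiberLine x (s x) t)) 0) a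
  have h1 := ((congrArg (fun l : TotalSpace F V → ℝ →L[ℝ] ℝ ↦
    ContMDiffAt (𝓘(ℝ, H).prod 𝓘(ℝ, F)) 𝓘(ℝ, ℝ →L[ℝ] ℝ) ∞ l a) e).mp h).clm_apply (contMDiffAt_const (c := (1 : ℝ)))
  refine h1.congr_of_eventuallyEq (Filter.Eventually.of_forall fun c ↦ ?_)
  exact dirDeriv_vlift (hL.mdifferentiable (by simp) _) _

theorem isLocalDiffeomorphAt_trivialization (t : Trivialization F (π F V))
    [MemTrivializationAtlas t] {a : TotalSpace F V} (ha : a ∈ t.source) :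
    IsLocalDiffeomorphAt (𝓘(ℝ, H).prod 𝓘(ℝ, F)) (𝓘(ℝ, H).prod 𝓘(ℝ, F)) ∞ t a :=
  ⟨{ t.toPartialEquiv with
      open_source := t.open_source
      open_target := t.open_target
      contMDiffOn_toFun := t.contMDiffOn
      contMDiffOn_invFun := t.contMDiffOn_symm }, ha, fun _ _ ↦ rfl⟩

/-- The derivative of a local trivialization. -/
def trivDeriv (t : Trivialization F (π F V)) [MemTrivializationAtlas t] {a : TotalSpace F V}
    (ha : a ∈ t.source) :
    TangentSpace (𝓘(ℝ, H).prod 𝓘(ℝ, F)) a ≃L[ℝ] TangentSpace (𝓘(ℝ, H).prod 𝓘(ℝ, F)) (t a) :=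
  (isLocalDiffeomorphAt_trivialization t ha).mfderivToContinuousLinearEquiv (by simp)

theorem trivDeriv_apply (t : Trivialization F (π F V)) [MemTrivializationAtlas t]
    {a : TotalSpace F V} (ha : a ∈ t.source) (v : TangentSpace (𝓘(ℝ, H).prod 𝓘(ℝ, F)) a) :
    trivDeriv t ha v = mfderiv (𝓘(ℝ, H).prod 𝓘(ℝ, F)) (𝓘(ℝ, H).prod 𝓘(ℝ, F)) t a v := rfl

theorem mdifferentiableAt_trivialization (t : Trivialization F (π F V)) [MemTrivializationAtlas t]
    {a : TotalSpace F V} (ha : a ∈ t.source) :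
    MDifferentiableAt (𝓘(ℝ, H).prod 𝓘(ℝ, F)) (𝓘(ℝ, H).prod 𝓘(ℝ, F)) t a :=
  (isLocalDiffeomorphAt_trivialization t ha).mdifferentiableAt (by simp)

theorem fst_trivDeriv (t : Trivialization F (π F V)) [MemTrivializationAtlas t]
    {a : TotalSpace F V} (ha : a ∈ t.source) (v : TangentSpace (𝓘(ℝ, H).prod 𝓘(ℝ, F)) a) :
    (trivDeriv t ha v).1 = mfderiv (𝓘(ℝ, H).prod 𝓘(ℝ, F)) 𝓘(ℝ, H) (π F V) a v := by
  have h : π F V =ᶠ[nhds a] Prod.fst ∘ t := by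
    filter_upwards [t.open_source.mem_nhds ha] with c hc using (t.coe_fst hc).symm
  rw [h.mfderiv_eq]
  refine Eq.symm ((mfderiv_comp_apply a mdifferentiableAt_fst
    (mdifferentiableAt_trivialization t ha) v).trans ?_)
  rw [mfderiv_fst]
  rfl

/-- In a trivialization a fibre line is an affine line in `F` over a fixed base point. Linearity of
the lift and the description of the vertical vectors are read off from this. -/
theorem trivDeriv_vlift (t : Trivialization F (π F V)) [MemTrivializationAtlas t]
    {a : TotalSpace F V} (ha : a ∈ t.source) (b : V a.proj) :
    trivDeriv (H := H) t ha (vlift a b) = ((0 : H), t.linearMapAt ℝ a.proj b) := by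
  have hb : a.proj ∈ t.baseSet := t.mem_source.1 ha
  rw [trivDeriv_apply, mfderiv_vlift (mdifferentiableAt_trivialization t ha)]
  have h : (fun s : ℝ ↦ t (fiberLine a b s)) =
      fun s ↦ (a.proj, t.linearMapAt ℝ a.proj a.2 + s • t.linearMapAt ℝ a.proj b) := by
    ext1 s
    have h2 := t.linearMapAt_apply (R := ℝ) (b := a.proj)
    simp only [hb, if_true] at h2
    rw [← map_smul, ← map_add, h2]
    exact Prod.ext (t.coe_fst' hb) rfl
  have h3 : HasFDerivAt (fun s : ℝ ↦ t.linearMapAt ℝ a.proj a.2 + s • t.linearMapAt ℝ a.proj b)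
      ((1 : ℝ →L[ℝ] ℝ).smulRight (t.linearMapAt ℝ a.proj b)) 0 :=
    ((hasFDerivAt_id (0 : ℝ)).smul_const _).const_add _
  have h4 : HasMFDerivAt 𝓘(ℝ, ℝ) (𝓘(ℝ, H).prod 𝓘(ℝ, F)) (fun s : ℝ ↦ t (fiberLine a b s)) 0
      ((0 : ℝ →L[ℝ] H).prod ((1 : ℝ →L[ℝ] ℝ).smulRight (t.linearMapAt ℝ a.proj b))) := by
    rw [h]
    exact (hasMFDerivAt_const a.proj (0 : ℝ)).prodMk h3.hasMFDerivAt
  refine (congrArg (fun l : ℝ →L[ℝ] H × F ↦ l 1) h4.mfderiv).trans ?_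
  refine Prod.ext rfl ?_
  exact one_smul ℝ (t.linearMapAt ℝ a.proj b)

theorem isLinearMap_vlift (a : TotalSpace F V) : IsLinearMap ℝ (vlift (H := H) a) := by
  have ha := FiberBundle.mem_trivializationAt_proj_source (F := F) (E := V) (x := a)
  have hz : ((0 : H), (0 : F)) = 0 := rfl
  constructor
  · intro b c
    apply (trivDeriv (H := H) _ ha).injective
    rw [map_add, trivDeriv_vlift, trivDeriv_vlift, trivDeriv_vlift, map_add]
    exact Prod.ext (add_zero (0 : H)).symm rfl
  · intro r b
    apply (trivDeriv (H := H) _ ha).injective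
    rw [map_smul, trivDeriv_vlift, trivDeriv_vlift, map_smul]
    exact Prod.ext (smul_zero r).symm rfl

theorem mfderiv_proj_vlift (a : TotalSpace F V) (b : V a.proj) :
    mfderiv (𝓘(ℝ, H).prod 𝓘(ℝ, F)) 𝓘(ℝ, H) (π F V) a (vlift a b) = 0 := by
  have ha := FiberBundle.mem_trivializationAt_proj_source (F := F) (E := V) (x := a)
  rw [← fst_trivDeriv _ ha, trivDeriv_vlift]
  rfl

theorem exists_vlift_eq {a : TotalSpace F V} {v : TangentSpace (𝓘(ℝ, H).prod 𝓘(ℝ, F)) a}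
    (hv : mfderiv (𝓘(ℝ, H).prod 𝓘(ℝ, F)) 𝓘(ℝ, H) (π F V) a v = 0) :
    ∃ b, vlift a b = v := by
  have ha := FiberBundle.mem_trivializationAt_proj_source (F := F) (E := V) (x := a)
  rw [← fst_trivDeriv _ ha] at hv
  refine ⟨(trivializationAt F V a.proj).symmₗ ℝ a.proj (trivDeriv (H := H) _ ha v).2,
    (trivDeriv (H := H) _ ha).injective ?_⟩
  rw [trivDeriv_vlift,
    (trivializationAt F V a.proj).linearMapAt_symmₗ ((Trivialization.mem_source _).1 ha)]
  exact Prod.ext hv.symm rfl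

theorem mfderiv_proj_surjective (a : TotalSpace F V) :
    Function.Surjective (mfderiv (𝓘(ℝ, H).prod 𝓘(ℝ, F)) 𝓘(ℝ, H) (π F V) a) := by
  have ha := FiberBundle.mem_trivializationAt_proj_source (F := F) (E := V) (x := a)
  intro ξ
  obtain ⟨v, hv⟩ := (trivDeriv (H := H) _ ha).surjective ((ξ, (0 : F)) : H × F)
  exact ⟨v, by rw [← fst_trivDeriv _ ha, hv]⟩

end Vertical

/-! ### Projectable sections, the Cartan 2-form and the dynamics -/

section CartanForm

variable {H : Type*} [NormedAddCommGroup H] [NormedSpace ℝ H] [FiniteDimensional ℝ H]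
  {M : Type*} [TopologicalSpace M] [ChartedSpace H M] [IsManifold 𝓘(ℝ, H) ∞ M] [T2Space M]
  {F : Type*} [NormedAddCommGroup F] [NormedSpace ℝ F] [FiniteDimensional ℝ F]
  {V : M → Type*} [TopologicalSpace (TotalSpace F V)]
  [∀ x, TopologicalSpace (V x)] [∀ x, AddCommGroup (V x)] [∀ x, Module ℝ (V x)]
  [FiberBundle F V] [VectorBundle ℝ F V] [ContMDiffVectorBundle ∞ F V 𝓘(ℝ, H)]

theorem contMDiff_prod_const_vectorField {Y : ∀ x : M, TangentSpace 𝓘(ℝ, H) x}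
    (hY : ContMDiff 𝓘(ℝ, H) 𝓘(ℝ, H).tangent ∞
      (fun x ↦ (⟨x, Y x⟩ : TangentBundle 𝓘(ℝ, H) M))) (w : F) :
    ContMDiff (𝓘(ℝ, H).prod 𝓘(ℝ, F)) (𝓘(ℝ, H).prod 𝓘(ℝ, F)).tangent ∞
      (fun p : M × F ↦ (⟨p, (Y p.1, w)⟩ : TangentBundle (𝓘(ℝ, H).prod 𝓘(ℝ, F)) (M × F))) := by
  have hw : ContMDiff 𝓘(ℝ, F) 𝓘(ℝ, F).tangent ∞
      (fun u : F ↦ (⟨u, w⟩ : TangentBundle 𝓘(ℝ, F) F)) :=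
    contMDiff_vectorSpace_iff_contDiff.2 contDiff_const
  exact contMDiff_equivTangentBundleProd_symm.comp
    ((hY.comp contMDiff_fst).prodMk (hw.comp contMDiff_snd))

namespace LieAlgebroid

variable (A : LieAlgebroid H F V)

/-- This makes `dθ_L` unique, so that `cartanTwoForm` can be computed. Extend `b` to a section `s`;
in a trivialization take the vector field with base part `ρ(s)` and constant fibre part, chosen to
match `v` at `a`. Multiplying section and field by the same cutoff keeps the condition `ρ(b) =
Tτ(v)`, which is linear. -/
theorem exists_projSection (a : TotalSpace F V) (z : A.Prol a) :
    ∃ Z : A.ProjSection, Z.val a = z := by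
  obtain ⟨⟨b, v⟩, hz⟩ := z
  obtain ⟨fr⟩ := FrameAt.exists (H := H) (F := F) (V := V) a.proj
  let t := trivializationAt F V a.proj
  have ha : a ∈ t.source := FiberBundle.mem_trivializationAt_proj_source
  obtain ⟨χ, hχ, hsupp⟩ := exists_bump (H := H) (t.open_baseSet.mem_nhds
    (mem_baseSet_trivializationAt F V a.proj))
  let s := fr.extend b
  have hs : s a.proj = b := fr.extend_self b
  let Y : ∀ x : M, TangentSpace 𝓘(ℝ, H) x := fun x ↦ A.anchor x (s x)
  have hY : ContMDiff 𝓘(ℝ, H) 𝓘(ℝ, H).tangent ∞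
      (fun x ↦ (⟨x, Y x⟩ : TangentBundle 𝓘(ℝ, H) M)) := A.contMDiff_anchor.comp s.contMDiff
  let w : F := (trivDeriv t ha v).2
  let W : ∀ p : M × F, TangentSpace (𝓘(ℝ, H).prod 𝓘(ℝ, F)) p := fun p ↦ (Y p.1, w)
  let X := VectorField.mpullback (𝓘(ℝ, H).prod 𝓘(ℝ, F)) (𝓘(ℝ, H).prod 𝓘(ℝ, F)) t W
  have hX : ∀ c (hc : c ∈ t.source), X c = (trivDeriv t hc).symm (W (t c)) := fun c hc ↦
    congrArg (fun l : TangentSpace (𝓘(ℝ, H).prod 𝓘(ℝ, F)) (t c) →L[ℝ]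
      TangentSpace (𝓘(ℝ, H).prod 𝓘(ℝ, F)) c ↦ l (W (t c)))
      (ContinuousLinearMap.inverse_equiv (trivDeriv t hc))
  have hXs : ContMDiffOn (𝓘(ℝ, H).prod 𝓘(ℝ, F)) (𝓘(ℝ, H).prod 𝓘(ℝ, F)).tangent ∞
      (fun a ↦ (⟨a, X a⟩ : TangentBundle (𝓘(ℝ, H).prod 𝓘(ℝ, F)) (TotalSpace F V)))
      t.source := fun c hc ↦ by
    refine ContMDiffAt.contMDiffWithinAt ?_
    exact ContMDiffAt.mpullback_vectorField_preimage (n := ∞)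
      (contMDiff_prod_const_vectorField hY w (t c))
      (isLocalDiffeomorphAt_trivialization t hc).contMDiffAt ⟨trivDeriv t hc, rfl⟩ (by simp)
  refine ⟨{
    base := smulSection χ s
    field := fun c ↦ χ c.proj • X c
    contMDiff_field := ?_
    mem_prol := fun c ↦ ?_ }, ?_⟩
  · refine ContMDiffOn.smul_section_of_tsupport (ψ := fun c : TotalSpace F V ↦ χ c.proj)
      (χ.contMDiff.comp (contMDiff_proj V)).contMDiffOn t.open_source ?_ hXs
    refine (tsupport_comp_subset_preimage χ (FiberBundle.continuous_proj F V)).trans ?_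
    intro c hc
    exact t.mem_source.2 (hsupp hc)
  · change A.anchor c.proj (χ c.proj • s c.proj) = mfderiv (𝓘(ℝ, H).prod 𝓘(ℝ, F)) 𝓘(ℝ, H)
      (π F V) c (χ c.proj • X c)
    rw [map_smul, map_smul]
    by_cases hc : c ∈ t.source
    · rw [hX c hc, ← fst_trivDeriv t hc, ContinuousLinearEquiv.apply_symm_apply]
      congr 1
      change _ = Y (t c).1
      rw [t.coe_fst hc]
    · have : χ c.proj = 0 := image_eq_zero_of_notMem_tsupport fun h ↦
        hc (t.mem_source.2 (hsupp h))
      rw [this, zero_smul, zero_smul]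
  · refine Subtype.ext (Prod.ext ?_ ?_)
    · change χ a.proj • s a.proj = b
      rw [hχ, hs, one_smul]
    · change χ a.proj • X a = v
      rw [hχ, one_smul, hX a ha, ContinuousLinearEquiv.symm_apply_eq]
      refine Prod.ext ?_ rfl
      rw [fst_trivDeriv t ha, ← hz]
      change A.anchor (t a).1 (s (t a).1) = A.anchor a.proj b
      rw [t.coe_fst ha, hs]

end LieAlgebroid

/-- The fibre derivative of a function on `E` at `a`, a covector on the fibre through `a`. -/
def fiberDeriv (L : TotalSpace F V → ℝ) (a : TotalSpace F V) : V a.proj →ₗ[ℝ] ℝ :=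
  (mfderiv (𝓘(ℝ, H).prod 𝓘(ℝ, F)) 𝓘(ℝ, ℝ) L a).toLinearMap ∘ₗ
    (isLinearMap_vlift (H := H) a).mk' (vlift a)

theorem diffCovector_fiberDeriv {L : TotalSpace F V → ℝ}
    (hL : ContMDiff (𝓘(ℝ, H).prod 𝓘(ℝ, F)) 𝓘(ℝ, ℝ) ∞ L) (a : TotalSpace F V) :
    DiffCovector (G := π F V) H F (𝓘(ℝ, H).prod 𝓘(ℝ, F)) (fiberDeriv (H := H) L) a := fun σ ↦
  (contMDiff_dirDeriv_vlift hL (σ.contMDiff.comp (contMDiff_proj V))).mdifferentiable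
    (by simp) a

theorem contMDiff_energy {L : TotalSpace F V → ℝ}
    (hL : ContMDiff (𝓘(ℝ, H).prod 𝓘(ℝ, F)) 𝓘(ℝ, ℝ) ∞ L) :
    ContMDiff (𝓘(ℝ, H).prod 𝓘(ℝ, F)) 𝓘(ℝ, ℝ) ∞ (energy H L) :=
  (contMDiff_dirDeriv_vlift hL contMDiff_id).sub hL

namespace LieAlgebroid

variable (A : LieAlgebroid H F V)

theorem exists_isProlExtDeriv {L : TotalSpace F V → ℝ}
    (hL : ContMDiff (𝓘(ℝ, H).prod 𝓘(ℝ, F)) 𝓘(ℝ, ℝ) ∞ L) :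
    ∃ η, A.IsProlExtDeriv (cartanOneForm L) η := by
  have fr := fun x ↦ (FrameAt.exists (H := H) (F := F) (V := V) x).some
  refine ⟨fun a ↦ A.extDerivForm (G := π F V) (fr a.proj) (diffCovector_fiberDeriv hL a)
    (LinearMap.fst ℝ _ _ ∘ₗ (A.Prol a).subtype) (LinearMap.snd ℝ _ _ ∘ₗ (A.Prol a).subtype),
    fun Z₁ Z₂ a ↦ ?_⟩
  rw [extDerivForm_apply]
  -- The form `θ_L` ignores the tangent component, so `θ_L([Z₁, Z₂])` involves only the bracket of
  -- the base sections, and the defining formula is an instance of `extDerivAlong`.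
  refine A.extDerivAlong_congr (fr a.proj)
    ((contMDiff_proj V (n := ∞)).mdifferentiable (by simp) a) (diffCovector_fiberDeriv hL a)
    ?_ ?_ ?_ ?_
  · rw [FrameAt.extend_self]; exact Z₁.mem_prol a
  · rw [FrameAt.extend_self]; exact Z₂.mem_prol a
  · rw [FrameAt.extend_self]; rfl
  · rw [FrameAt.extend_self]; rfl

/-- Replaces the chosen form by a formula in which the base components may be extended by arbitrary
sections. -/
theorem cartanTwoForm_apply {L : TotalSpace F V → ℝ}
    (hL : ContMDiff (𝓘(ℝ, H).prod 𝓘(ℝ, F)) 𝓘(ℝ, ℝ) ∞ L) {a : TotalSpace F V}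
    (z₁ z₂ : A.Prol a) {σ₁ σ₂ : Cₛ^∞⟮𝓘(ℝ, H); F, V⟯} (h₁ : σ₁ a.proj = (z₁ : Pair H a).1)
    (h₂ : σ₂ a.proj = (z₂ : Pair H a).1) :
    A.cartanTwoForm L a ![z₁, z₂] = -A.extDerivAlong (G := π F V) (fiberDeriv (H := H) L) a σ₁ σ₂
      (z₁ : Pair H a).2 (z₂ : Pair H a).2 := by
  have hex := A.exists_isProlExtDeriv hL
  rw [cartanTwoForm, dif_pos hex, AlternatingMap.neg_apply]
  obtain ⟨Z₁, hZ₁⟩ := A.exists_projSection a z₁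
  obtain ⟨Z₂, hZ₂⟩ := A.exists_projSection a z₂
  obtain ⟨fr⟩ := FrameAt.exists (H := H) (F := F) (V := V) a.proj
  have h := hex.choose_spec Z₁ Z₂ a
  rw [hZ₁, hZ₂] at h
  rw [h, neg_inj]
  have e₁ : Z₁.base a.proj = (z₁ : Pair H a).1 := by rw [← hZ₁]; rfl
  have e₂ : Z₂.base a.proj = (z₂ : Pair H a).1 := by rw [← hZ₂]; rfl
  refine A.extDerivAlong_congr fr
    ((contMDiff_proj V (n := ∞)).mdifferentiable (by simp) a) (diffCovector_fiberDeriv hL a)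
    ?_ ?_ (e₁.trans h₁.symm) (e₂.trans h₂.symm)
  · rw [e₁]; exact z₁.2
  · rw [e₂]; exact z₂.2

/-- Nondegeneracy makes `z ↦ ω_L(z, ·)` injective from the fibre to its dual, hence bijective by
equality of finite dimensions. -/
theorem existsUnique_dynamics {L : TotalSpace F V → ℝ} {a : TotalSpace F V}
    (hreg : A.IsRegularAt L a) (f : TotalSpace F V → ℝ) :
    ∃! z : A.Prol a, ∀ w : A.Prol a, A.cartanTwoForm L a ![z, w] = prolD f a (w : Pair H a) := by
  have hfin : FiniteDimensional ℝ (V a.proj) :=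
    LinearEquiv.finiteDimensional ((trivializationAt F V a.proj).linearEquivAt ℝ a.proj
      (mem_baseSet_trivializationAt F V a.proj)).symm
  have hfin' : FiniteDimensional ℝ (TangentSpace (𝓘(ℝ, H).prod 𝓘(ℝ, F)) a) :=
    inferInstanceAs (FiniteDimensional ℝ (H × F))
  have hupd : ∀ z x y : A.Prol a, Function.update ![z, x] 1 y = ![z, y] := fun z x y ↦ by
    ext1 i; fin_cases i <;> rfl
  let B : A.Prol a →ₗ[ℝ] Module.Dual ℝ (A.Prol a) := LinearMap.mk₂ ℝ
    (fun z w ↦ A.cartanTwoForm L a ![z, w])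
    (fun x y w ↦ (A.cartanTwoForm L a).map_vecCons_add ![w] x y)
    (fun c x w ↦ (A.cartanTwoForm L a).map_vecCons_smul ![w] c x)
    (fun z x y ↦ by
      have h := (A.cartanTwoForm L a).map_update_add ![z, x] 1 x y
      rwa [hupd, hupd, hupd] at h)
    (fun c z x ↦ by
      have h := (A.cartanTwoForm L a).map_update_smul ![z, x] 1 c x
      rwa [hupd, hupd] at h)
  have hinj : Function.Injective B := (injective_iff_map_eq_zero B).2 fun z hz ↦
    hreg z fun w ↦ congrArg (fun l : Module.Dual ℝ (A.Prol a) ↦ l w) hz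
  have hsurj : Function.Surjective B :=
    (LinearMap.injective_iff_surjective_of_finrank_eq_finrank
      Subspace.dual_finrank_eq.symm).1 hinj
  let d : Module.Dual ℝ (A.Prol a) :=
    (mfderiv (𝓘(ℝ, H).prod 𝓘(ℝ, F)) 𝓘(ℝ, ℝ) f a).toLinearMap ∘ₗ
      LinearMap.snd ℝ _ _ ∘ₗ (A.Prol a).subtype
  obtain ⟨z, hz⟩ := hsurj d
  refine ⟨z, fun w ↦ congrArg (fun l : Module.Dual ℝ (A.Prol a) ↦ l w) hz, fun y hy ↦ hinj ?_⟩
  rw [hz]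
  exact LinearMap.ext hy

theorem existsUnique_isFreeDynamics {L : TotalSpace F V → ℝ} (hreg : A.IsRegular L) :
    ∃! Γ, A.IsFreeDynamics L Γ := by
  choose Γ hΓ huniq using fun a ↦ A.existsUnique_dynamics (hreg a) (energy H L)
  exact ⟨Γ, hΓ, fun Γ' h ↦ funext fun a ↦ huniq a (Γ' a) (h a)⟩

end LieAlgebroid

end CartanForm

/-! ### Forms of degree 0 and 1 and their differentials -/

section OneForms

variable {H : Type*} [NormedAddCommGroup H] [NormedSpace ℝ H]
  {M : Type*} [TopologicalSpace M] [ChartedSpace H M] [IsManifold 𝓘(ℝ, H) ∞ M]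
  {F : Type*} [NormedAddCommGroup F] [NormedSpace ℝ F]
  {V : M → Type*} [TopologicalSpace (TotalSpace F V)]
  [∀ x, TopologicalSpace (V x)] [∀ x, AddCommGroup (V x)] [∀ x, Module ℝ (V x)]
  [FiberBundle F V] [VectorBundle ℝ F V] [ContMDiffVectorBundle ∞ F V 𝓘(ℝ, H)]

/-- Tangent vectors are separated by globally defined smooth functions. -/
theorem tangent_ext [FiniteDimensional ℝ H] [T2Space M] {m : M} {ξ ζ : TangentSpace 𝓘(ℝ, H) m}
    (h : ∀ f : C^∞⟮𝓘(ℝ, H), M; ℝ⟯, dirDeriv 𝓘(ℝ, H) f m ξ = dirDeriv 𝓘(ℝ, H) f m ζ) :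
    ξ = ζ := by
  obtain ⟨χ, -⟩ := (SmoothBumpFunction.nhds_basis_tsupport (I := 𝓘(ℝ, H)) m).ex_mem
  -- A cut-off chart: globally smooth, and equal to the chart near `m`, so its differential at `m`
  -- is injective. Linear functionals of `g` serve as test functions.
  let g : M → H := fun x ↦ χ x • extChartAt 𝓘(ℝ, H) m x
  have hg : ContMDiff 𝓘(ℝ, H) 𝓘(ℝ, H) ∞ g := χ.contMDiff_smul (contMDiffOn_extChartAt)
  have hgd : mfderiv 𝓘(ℝ, H) 𝓘(ℝ, H) g m =
      mfderiv 𝓘(ℝ, H) 𝓘(ℝ, H) (extChartAt 𝓘(ℝ, H) m) m := by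
    refine Filter.EventuallyEq.mfderiv_eq ?_
    filter_upwards [χ.eventuallyEq_one] with x hx
    change χ x • _ = _
    rw [hx]
    exact one_smul ℝ _
  have hinj : Function.Injective (mfderiv 𝓘(ℝ, H) 𝓘(ℝ, H) g m) := by
    rw [hgd]
    exact (isInvertible_mfderiv_extChartAt (mem_extChartAt_source m)).injective
  apply hinj
  refine (SeparatingDual.eq_iff_forall_dual_eq (R := ℝ) (V := H)).2 fun l ↦ ?_
  have key : ∀ v : TangentSpace 𝓘(ℝ, H) m, dirDeriv 𝓘(ℝ, H) (fun x ↦ l (g x)) m v =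
      l (mfderiv 𝓘(ℝ, H) 𝓘(ℝ, H) g m v) := fun v ↦ by
    rw [dirDeriv_comp (I' := 𝓘(ℝ, H)) (l.contMDiff.mdifferentiable (n := ∞) (by simp) _)
      (hg.mdifferentiable (by simp) _), dirDeriv, l.mfderiv_eq]
    rfl
  have := h ⟨fun x ↦ l (g x), l.contMDiff.comp hg⟩
  exact (key ξ).symm.trans (this.trans (key ζ))

/-- A field of covectors as a 1-form. -/
def oneForm (lam : ∀ x, V x →ₗ[ℝ] ℝ) (x : M) : V x [⋀^Fin 1]→ₗ[ℝ] ℝ :=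
  AlternatingMap.ofSubsingleton ℝ (V x) ℝ (0 : Fin 1) (lam x)

theorem oneForm_apply (lam : ∀ x, V x →ₗ[ℝ] ℝ) (x : M) (w : Fin 1 → V x) :
    oneForm lam x w = lam x (w 0) := rfl

/-- A function as a 0-form. -/
def zeroForm (V : M → Type*) [∀ x, AddCommGroup (V x)] [∀ x, Module ℝ (V x)] (f : M → ℝ) (x : M) :
    V x [⋀^Fin 0]→ₗ[ℝ] ℝ :=
  AlternatingMap.constOfIsEmpty ℝ (V x) (Fin 0) (f x)

namespace LieAlgebroid

variable (A : LieAlgebroid H F V)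

theorem isExtDeriv_zeroForm_iff (f : M → ℝ) (lam : ∀ x, V x →ₗ[ℝ] ℝ) :
    A.IsExtDeriv (zeroForm V f) (oneForm lam) ↔ ∀ (σ : Cₛ^∞⟮𝓘(ℝ, H); F, V⟯) (x : M),
      lam x (σ x) = dirDeriv 𝓘(ℝ, H) f x (A.anchor x (σ x)) := by
  have key : ∀ (σ : Fin 1 → Cₛ^∞⟮𝓘(ℝ, H); F, V⟯) (x : M),
      (∑ i : Fin 1, (-1 : ℝ) ^ (i : ℕ) *
        dirDeriv 𝓘(ℝ, H) (fun y ↦ zeroForm V f y (i.removeNth (fun k ↦ σ k y))) x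
          (A.anchor x (σ i x)) + A.bracketSum 0 (zeroForm V f) σ x) =
        dirDeriv 𝓘(ℝ, H) f x (A.anchor x (σ 0 x)) := fun σ x ↦ by
    rw [Fin.sum_univ_one, Fin.val_zero, pow_zero, one_mul]
    exact add_zero _
  constructor
  · intro h σ x
    exact (h (fun _ ↦ σ) x).trans (key _ x)
  · intro h σ x
    rw [key]
    exact h (σ 0) x

theorem isExtDeriv_oneForm_iff (lam : ∀ x, V x →ₗ[ℝ] ℝ) (η : ∀ x, V x [⋀^Fin 2]→ₗ[ℝ] ℝ) :
    A.IsExtDeriv (oneForm lam) η ↔ ∀ (σ : Fin 2 → Cₛ^∞⟮𝓘(ℝ, H); F, V⟯) (x : M),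
      η x (fun i ↦ σ i x) = A.extDerivAlong (I := 𝓘(ℝ, H)) (G := fun y ↦ y) lam x (σ 0) (σ 1)
        (A.anchor x (σ 0 x)) (A.anchor x (σ 1 x)) := by
  refine forall_congr' fun σ ↦ forall_congr' fun x ↦ ?_
  have hb : A.bracketSum 1 (oneForm lam) σ x = -lam x (A.bracket (σ 0) (σ 1) x) := by
    simp [bracketSum, oneForm_apply]
  rw [hb, Fin.sum_univ_two]
  simp only [oneForm_apply, extDerivAlong, Fin.val_zero, Fin.val_one, pow_zero, pow_one, one_mul,
    neg_mul, sub_eq_add_neg]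
  rfl

/-- The morphism condition speaks of pairs of a form and its differential, so it can be applied to a
1-form only once the differential is known to exist. -/
theorem exists_isExtDeriv_oneForm [FiniteDimensional ℝ H] [T2Space M] [FiniteDimensional ℝ F]
    {lam : ∀ x, V x →ₗ[ℝ] ℝ}
    (hlam : ∀ σ : Cₛ^∞⟮𝓘(ℝ, H); F, V⟯, ContMDiff 𝓘(ℝ, H) 𝓘(ℝ, ℝ) ∞ (fun x ↦ lam x (σ x))) :
    ∃ η, A.IsExtDeriv (oneForm lam) η := by
  have fr := fun y ↦ (FrameAt.exists (H := H) (F := F) (V := V) y).some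
  have hd : ∀ y, DiffCovector (G := fun y ↦ y) H F 𝓘(ℝ, H) lam y := fun y σ ↦
    (hlam σ).mdifferentiable (by simp) y
  have hid : ∀ (y : M) (v : TangentSpace 𝓘(ℝ, H) y),
      v = mfderiv 𝓘(ℝ, H) 𝓘(ℝ, H) (fun y ↦ y) y v := fun y v ↦
    (congrArg (fun l : TangentSpace 𝓘(ℝ, H) y →L[ℝ] TangentSpace 𝓘(ℝ, H) y ↦ l v)
      (mfderiv_id (I := 𝓘(ℝ, H)) (x := y))).symm
  refine ⟨fun y ↦ A.extDerivForm (G := fun y ↦ y) (fr y) (hd y) LinearMap.id (A.anchor y),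
    (A.isExtDeriv_oneForm_iff lam _).2 fun σ y ↦ ?_⟩
  rw [extDerivForm_apply]
  exact A.extDerivAlong_congr (G := fun y ↦ y) (fr y) mdifferentiableAt_id (hd y)
    (by rw [FrameAt.extend_self]; exact hid _ _) (by rw [FrameAt.extend_self]; exact hid _ _)
    (FrameAt.extend_self _ _) (FrameAt.extend_self _ _)

end LieAlgebroid

end OneForms

/-! ### Morphisms in degrees 0 and 1 and the prolonged map -/

section Morphism

variable {H : Type*} [NormedAddCommGroup H] [NormedSpace ℝ H] [FiniteDimensional ℝ H]
  {M : Type*} [TopologicalSpace M] [ChartedSpace H M] [IsManifold 𝓘(ℝ, H) ∞ M] [T2Space M]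
  {F : Type*} [NormedAddCommGroup F] [NormedSpace ℝ F] [FiniteDimensional ℝ F]
  {V : M → Type*} [TopologicalSpace (TotalSpace F V)]
  [∀ x, TopologicalSpace (V x)] [∀ x, AddCommGroup (V x)] [∀ x, Module ℝ (V x)]
  [FiberBundle F V] [VectorBundle ℝ F V] [ContMDiffVectorBundle ∞ F V 𝓘(ℝ, H)]
  {H' : Type*} [NormedAddCommGroup H'] [NormedSpace ℝ H'] [FiniteDimensional ℝ H']
  {M' : Type*} [TopologicalSpace M'] [ChartedSpace H' M'] [IsManifold 𝓘(ℝ, H') ∞ M']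
  [T2Space M']
  {F' : Type*} [NormedAddCommGroup F'] [NormedSpace ℝ F'] [FiniteDimensional ℝ F']
  {V' : M' → Type*} [TopologicalSpace (TotalSpace F' V')]
  [∀ x, TopologicalSpace (V' x)] [∀ x, AddCommGroup (V' x)] [∀ x, Module ℝ (V' x)]
  [FiberBundle F' V'] [VectorBundle ℝ F' V'] [ContMDiffVectorBundle ∞ F' V' 𝓘(ℝ, H')]

namespace BundleMap

variable {A : LieAlgebroid H F V} {A' : LieAlgebroid H' F' V'}
  {Φ : BundleMap H F V H' F' V'}

theorem contMDiff_total' (Φ : BundleMap H F V H' F' V') :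
    ContMDiff (𝓘(ℝ, H).prod 𝓘(ℝ, F)) (𝓘(ℝ, H').prod 𝓘(ℝ, F')) ∞ Φ.total := Φ.contMDiff_total

theorem mdifferentiableAt_total (Φ : BundleMap H F V H' F' V') (a : TotalSpace F V) :
    MDifferentiableAt (𝓘(ℝ, H).prod 𝓘(ℝ, F)) (𝓘(ℝ, H').prod 𝓘(ℝ, F')) Φ.total a :=
  Φ.contMDiff_total.mdifferentiable (by simp) a

theorem mdifferentiableAt_base (Φ : BundleMap H F V H' F' V') (x : M) :
    MDifferentiableAt 𝓘(ℝ, H) 𝓘(ℝ, H') Φ.base x :=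
  Φ.contMDiff_base.mdifferentiable (by simp) x

/-- This is the morphism condition on functions, `Φ^⋆ df = d(f ∘ φ)`, since smooth functions
separate tangent vectors. -/
theorem IsMorphism.anchor_fiber (hΦ : Φ.IsMorphism A A') (x : M) (b : V x) :
    A'.anchor (Φ.base x) (Φ.fiber x b) =
      mfderiv 𝓘(ℝ, H) 𝓘(ℝ, H') Φ.base x (A.anchor x b) := by
  refine tangent_ext fun f ↦ ?_
  obtain ⟨fr⟩ := FrameAt.exists (H := H) (F := F) (V := V) x
  have h := hΦ 0 (zeroForm V' f)
    (oneForm fun y ↦ (mfderiv 𝓘(ℝ, H') 𝓘(ℝ, ℝ) f y).toLinearMap ∘ₗ A'.anchor y)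
    (fun σ ↦ f.contMDiff) ((A'.isExtDeriv_zeroForm_iff _ _).2 fun σ y ↦ rfl)
  have h' := (A.isExtDeriv_zeroForm_iff (f ∘ Φ.base)
    (fun y ↦ ((mfderiv 𝓘(ℝ, H') 𝓘(ℝ, ℝ) f (Φ.base y)).toLinearMap ∘ₗ
      A'.anchor (Φ.base y)) ∘ₗ Φ.fiber y)).1 h (fr.extend b) x
  rw [fr.extend_self] at h'
  exact h'.trans (dirDeriv_comp (f.contMDiff.mdifferentiable (by simp) _)
    (Φ.mdifferentiableAt_base x) _)

/-- The morphism condition on 1-forms. The sections need to be related only at `x`, because `dλ` is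
a form and its value depends only on the vectors there. -/
theorem IsMorphism.extDerivAlong_comp_fiber (hΦ : Φ.IsMorphism A A')
    {lam : ∀ x, V' x →ₗ[ℝ] ℝ}
    (hlam : ∀ σ : Cₛ^∞⟮𝓘(ℝ, H'); F', V'⟯, ContMDiff 𝓘(ℝ, H') 𝓘(ℝ, ℝ) ∞ (fun x ↦ lam x (σ x)))
    {x : M} {σ₁ σ₂ : Cₛ^∞⟮𝓘(ℝ, H); F, V⟯} {η₁ η₂ : Cₛ^∞⟮𝓘(ℝ, H'); F', V'⟯}
    (h₁ : Φ.fiber x (σ₁ x) = η₁ (Φ.base x)) (h₂ : Φ.fiber x (σ₂ x) = η₂ (Φ.base x)) :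
    A.extDerivAlong (I := 𝓘(ℝ, H)) (G := fun y ↦ y) (fun y ↦ lam (Φ.base y) ∘ₗ Φ.fiber y) x σ₁ σ₂
        (A.anchor x (σ₁ x)) (A.anchor x (σ₂ x)) =
      A'.extDerivAlong (I := 𝓘(ℝ, H')) (G := fun y ↦ y) lam (Φ.base x) η₁ η₂
        (A'.anchor _ (η₁ (Φ.base x))) (A'.anchor _ (η₂ (Φ.base x))) := by
  obtain ⟨η, hη⟩ := A'.exists_isExtDeriv_oneForm hlam
  have h := hΦ 1 (oneForm lam) η (fun σ ↦ hlam (σ 0)) hη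
  have h' := (A.isExtDeriv_oneForm_iff (fun y ↦ lam (Φ.base y) ∘ₗ Φ.fiber y) _).1 h ![σ₁, σ₂] x
  have h'' := (A'.isExtDeriv_oneForm_iff lam η).1 hη ![η₁, η₂] (Φ.base x)
  refine h'.symm.trans (Eq.trans ?_ h'')
  refine congrArg (η (Φ.base x)) (funext fun i ↦ ?_)
  fin_cases i
  · exact h₁
  · exact h₂

theorem mfderiv_total_vlift (Φ : BundleMap H F V H' F' V') (a : TotalSpace F V) (b : V a.proj) :
    mfderiv (𝓘(ℝ, H).prod 𝓘(ℝ, F)) (𝓘(ℝ, H').prod 𝓘(ℝ, F')) Φ.total a (vlift a b) =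
      vlift (Φ.total a) (Φ.fiber a.proj b) := by
  rw [mfderiv_vlift (Φ.mdifferentiableAt_total a)]
  have : (fun t : ℝ ↦ Φ.total (fiberLine a b t)) =
      fun t ↦ fiberLine (Φ.total a) (Φ.fiber a.proj b) t := by
    ext1 t
    exact congrArg (TotalSpace.mk (Φ.base a.proj))
      (((Φ.fiber a.proj).map_add _ _).trans (congrArg _ ((Φ.fiber a.proj).map_smul t b)))
  exact congrArg (fun f : ℝ → TotalSpace F' V' ↦
    (mfderiv 𝓘(ℝ, ℝ) (𝓘(ℝ, H').prod 𝓘(ℝ, F')) f 0 : ℝ →L[ℝ] H' × F') 1) this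

theorem mfderiv_proj_total (Φ : BundleMap H F V H' F' V') (a : TotalSpace F V)
    (v : TangentSpace (𝓘(ℝ, H).prod 𝓘(ℝ, F)) a) :
    mfderiv (𝓘(ℝ, H').prod 𝓘(ℝ, F')) 𝓘(ℝ, H') (π F' V') (Φ.total a)
        (mfderiv (𝓘(ℝ, H).prod 𝓘(ℝ, F)) (𝓘(ℝ, H').prod 𝓘(ℝ, F')) Φ.total a v) =
      mfderiv 𝓘(ℝ, H) 𝓘(ℝ, H') Φ.base a.proj
        (mfderiv (𝓘(ℝ, H).prod 𝓘(ℝ, F)) 𝓘(ℝ, H) (π F V) a v) := by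
  have h₁ := mfderiv_comp_apply a (g := π F' V') (f := Φ.total)
    ((contMDiff_proj V' (n := ∞)).mdifferentiable (by simp) _) (Φ.mdifferentiableAt_total a) v
  have h₂ := mfderiv_comp_apply a (g := Φ.base) (f := π F V) (Φ.mdifferentiableAt_base _)
    ((contMDiff_proj V (n := ∞)).mdifferentiable (by simp) _) v
  exact h₁.symm.trans h₂

theorem IsMorphism.prolong_mem (hΦ : Φ.IsMorphism A A') {a : TotalSpace F V} (z : A.Prol a) :
    Φ.prolong a (z : Pair H a) ∈ A'.Prol (Φ.total a) := by
  refine Eq.trans ?_ (Φ.mfderiv_proj_total a _).symm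
  refine (hΦ.anchor_fiber a.proj _).trans ?_
  exact congrArg _ z.2

/-- Lift `b'` to `b`, then `ρ(b)` to some `v`. Both `v'` and `TΦ(v)` project to `ρ'(Φ(b))`, so they
differ by a vertical vector `c'^V`; adding to `v` the vertical lift of a preimage of `c'` corrects
the error. -/
theorem IsMorphism.exists_prolong_eq (hΦ : Φ.IsMorphism A A')
    (hsurj : ∀ x, Function.Surjective (Φ.fiber x)) {a : TotalSpace F V}
    (z' : A'.Prol (Φ.total a)) :
    ∃ z : A.Prol a, Φ.prolong a (z : Pair H a) = z' := by
  obtain ⟨⟨b', v'⟩, hz'⟩ := z'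
  obtain ⟨b, rfl⟩ := hsurj a.proj b'
  obtain ⟨v, hv⟩ := mfderiv_proj_surjective (H := H) a (A.anchor a.proj b)
  have hz'' : A'.anchor (Φ.base a.proj) (Φ.fiber a.proj b) =
    mfderiv (𝓘(ℝ, H').prod 𝓘(ℝ, F')) 𝓘(ℝ, H') (π F' V') (Φ.total a) v' := hz'
  have hvert : mfderiv (𝓘(ℝ, H').prod 𝓘(ℝ, F')) 𝓘(ℝ, H') (π F' V') (Φ.total a)
      (v' - mfderiv (𝓘(ℝ, H).prod 𝓘(ℝ, F)) (𝓘(ℝ, H').prod 𝓘(ℝ, F')) Φ.total a v) = 0 := by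
    rw [map_sub, Φ.mfderiv_proj_total, hv, ← hΦ.anchor_fiber, ← hz'']
    exact sub_self _
  obtain ⟨c', hc'⟩ := exists_vlift_eq hvert
  obtain ⟨c, rfl⟩ := hsurj a.proj c'
  refine ⟨⟨(b, v + vlift a c), ?_⟩, Prod.ext rfl ?_⟩
  · change A.anchor a.proj b =
      mfderiv (𝓘(ℝ, H).prod 𝓘(ℝ, F)) 𝓘(ℝ, H) (π F V) a (v + vlift a c)
    rw [map_add, hv, mfderiv_proj_vlift, add_zero]
  · change mfderiv (𝓘(ℝ, H).prod 𝓘(ℝ, F)) (𝓘(ℝ, H').prod 𝓘(ℝ, F')) Φ.total a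
      (v + vlift a c) = v'
    rw [map_add, Φ.mfderiv_total_vlift]
    exact (congrArg _ hc').trans (add_sub_cancel _ _)

end BundleMap

end Morphism

/-! ### Pullback of the Cartan form and reduction of the dynamics -/

section Reduction

variable {H : Type*} [NormedAddCommGroup H] [NormedSpace ℝ H] [FiniteDimensional ℝ H]
  {M : Type*} [TopologicalSpace M] [ChartedSpace H M] [IsManifold 𝓘(ℝ, H) ∞ M] [T2Space M]
  {F : Type*} [NormedAddCommGroup F] [NormedSpace ℝ F] [FiniteDimensional ℝ F]
  {V : M → Type*} [TopologicalSpace (TotalSpace F V)]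
  [∀ x, TopologicalSpace (V x)] [∀ x, AddCommGroup (V x)] [∀ x, Module ℝ (V x)]
  [FiberBundle F V] [VectorBundle ℝ F V] [ContMDiffVectorBundle ∞ F V 𝓘(ℝ, H)]
  {H' : Type*} [NormedAddCommGroup H'] [NormedSpace ℝ H'] [FiniteDimensional ℝ H']
  {M' : Type*} [TopologicalSpace M'] [ChartedSpace H' M'] [IsManifold 𝓘(ℝ, H') ∞ M']
  [T2Space M']
  {F' : Type*} [NormedAddCommGroup F'] [NormedSpace ℝ F'] [FiniteDimensional ℝ F']
  {V' : M' → Type*} [TopologicalSpace (TotalSpace F' V')]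
  [∀ x, TopologicalSpace (V' x)] [∀ x, AddCommGroup (V' x)] [∀ x, Module ℝ (V' x)]
  [FiberBundle F' V'] [VectorBundle ℝ F' V'] [ContMDiffVectorBundle ∞ F' V' 𝓘(ℝ, H')]

namespace BundleMap

variable {A : LieAlgebroid H F V} {A' : LieAlgebroid H' F' V'}
  {Φ : BundleMap H F V H' F' V'} {L' : TotalSpace F' V' → ℝ}

/-- The fibre derivative of `L'` along `Φ`. -/
def momentum (Φ : BundleMap H F V H' F' V') (L' : TotalSpace F' V' → ℝ) (c : TotalSpace F V) :
    V' (Φ.base c.proj) →ₗ[ℝ] ℝ :=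
  fiberDeriv (H := H') L' (Φ.total c)

theorem fiberDeriv_comp_total (hL' : ContMDiff (𝓘(ℝ, H').prod 𝓘(ℝ, F')) 𝓘(ℝ, ℝ) ∞ L')
    (a : TotalSpace F V) (b : V a.proj) :
    fiberDeriv (H := H) (L' ∘ Φ.total) a b =
      Φ.momentum L' a (Φ.fiber a.proj b) := by
  refine (dirDeriv_comp (hL'.mdifferentiable (by simp) _)
    (Φ.mdifferentiableAt_total a) _).trans ?_
  exact congrArg (dirDeriv (𝓘(ℝ, H').prod 𝓘(ℝ, F')) L' (Φ.total a)) (Φ.mfderiv_total_vlift a b)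

theorem energy_comp_total (hL' : ContMDiff (𝓘(ℝ, H').prod 𝓘(ℝ, F')) 𝓘(ℝ, ℝ) ∞ L') :
    energy H (L' ∘ Φ.total) = fun a ↦ energy H' L' (Φ.total a) := by
  ext a
  exact congrArg (· - L' (Φ.total a)) (fiberDeriv_comp_total hL' a a.2)

theorem prolD_energy_comp_total (hL' : ContMDiff (𝓘(ℝ, H').prod 𝓘(ℝ, F')) 𝓘(ℝ, ℝ) ∞ L')
    (a : TotalSpace F V) (z : Pair H a) :
    prolD (energy H (L' ∘ Φ.total)) a z = prolD (energy H' L') (Φ.total a) (Φ.prolong a z) := by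
  rw [energy_comp_total hL']
  exact dirDeriv_comp ((contMDiff_energy hL').mdifferentiable (by simp) _)
    (Φ.mdifferentiableAt_total a) _

/-- Comparison of the derivatives of the momenta of a section of `V` and of a section of `V'`
with related values at a point. -/
theorem dirDeriv_momentum_sub (hL' : ContMDiff (𝓘(ℝ, H').prod 𝓘(ℝ, F')) 𝓘(ℝ, ℝ) ∞ L')
    {a : TotalSpace F V} (fr : FrameAt H' F' V' (Φ.base a.proj))
    {σ : Cₛ^∞⟮𝓘(ℝ, H); F, V⟯} {η : Cₛ^∞⟮𝓘(ℝ, H'); F', V'⟯}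
    (h : Φ.fiber a.proj (σ a.proj) = η (Φ.base a.proj))
    (v : TangentSpace (𝓘(ℝ, H).prod 𝓘(ℝ, F)) a) {ξ : TangentSpace 𝓘(ℝ, H) a.proj}
    (hξ : ξ = mfderiv (𝓘(ℝ, H).prod 𝓘(ℝ, F)) 𝓘(ℝ, H) (π F V) a v)
    {ξ' : TangentSpace 𝓘(ℝ, H') (Φ.base a.proj)}
    (hξ' : ξ' = mfderiv 𝓘(ℝ, H) 𝓘(ℝ, H') Φ.base a.proj ξ) :
    dirDeriv (𝓘(ℝ, H).prod 𝓘(ℝ, F))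
        (fun c ↦ fiberDeriv (H := H) (L' ∘ Φ.total) c (σ c.proj)) a v -
      dirDeriv (𝓘(ℝ, H').prod 𝓘(ℝ, F')) (fun c ↦ fiberDeriv (H := H') L' c (η c.proj)) (Φ.total a)
        (mfderiv (𝓘(ℝ, H).prod 𝓘(ℝ, F)) (𝓘(ℝ, H').prod 𝓘(ℝ, F')) Φ.total a v) =
    ∑ j, (dirDeriv 𝓘(ℝ, H) (fun x ↦ fr.coord j (Φ.base x) (Φ.fiber x (σ x))) a.proj ξ -
      dirDeriv 𝓘(ℝ, H') (fun y ↦ fr.coord j y (η y)) (Φ.base a.proj) ξ') *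
        Φ.momentum L' a (fr.sec j (Φ.base a.proj)) := by
  have hπ : ContMDiff (𝓘(ℝ, H).prod 𝓘(ℝ, F)) 𝓘(ℝ, H) ∞ (π F V) := contMDiff_proj V
  have hη : ∀ η : Cₛ^∞⟮𝓘(ℝ, H'); F', V'⟯, ContMDiff (𝓘(ℝ, H').prod 𝓘(ℝ, F')) 𝓘(ℝ, ℝ) ∞
      (fun c ↦ fiberDeriv (H := H') L' c (η c.proj)) := fun η ↦
    contMDiff_dirDeriv_vlift hL' (η.contMDiff.comp (contMDiff_proj V'))
  have hησ : ContMDiff (𝓘(ℝ, H).prod 𝓘(ℝ, F)) 𝓘(ℝ, ℝ) ∞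
      (fun c ↦ fiberDeriv (H := H) (L' ∘ Φ.total) c (σ c.proj)) :=
    contMDiff_dirDeriv_vlift (hL'.comp Φ.contMDiff_total') (σ.contMDiff.comp hπ)
  have hηΦ : ∀ η : Cₛ^∞⟮𝓘(ℝ, H'); F', V'⟯, ContMDiff (𝓘(ℝ, H).prod 𝓘(ℝ, F)) 𝓘(ℝ, ℝ) ∞
      (fun c ↦ Φ.momentum L' c (η (Φ.base c.proj))) := fun η ↦ (hη η).comp Φ.contMDiff_total
  -- The defect of relatedness of `σ` and `η`, a section along `φ ∘ τ` vanishing at `a`. By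
  -- `dirDeriv_pairing`, no derivative of the momentum, hence no second derivative of `L'`, survives
  -- in the difference.
  let s : ∀ c : TotalSpace F V, V' (Φ.base c.proj) := fun c ↦
    Φ.fiber c.proj (σ c.proj) + (-1 : ℝ) • η (Φ.base c.proj)
  have hs : ContMDiff (𝓘(ℝ, H).prod 𝓘(ℝ, F)) (𝓘(ℝ, H').prod 𝓘(ℝ, F')) ∞
      (fun c ↦ (⟨Φ.base c.proj, s c⟩ : TotalSpace F' V')) :=
    contMDiff_add_smul (f := fun _ ↦ (-1 : ℝ)) (Φ.contMDiff_total.comp (σ.contMDiff.comp hπ))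
      (η.contMDiff.comp (Φ.contMDiff_base.comp hπ)) contMDiff_const
  have hs0 : s a = 0 := by
    simp only [s, h]
    rw [neg_one_smul, add_neg_cancel]
  have hpair : (fun c ↦ Φ.momentum L' c (s c)) =
      fun c ↦ fiberDeriv (H := H) (L' ∘ Φ.total) c (σ c.proj) -
        Φ.momentum L' c (η (Φ.base c.proj)) := by
    ext c
    rw [fiberDeriv_comp_total hL', sub_eq_add_neg, ← neg_one_mul, ← smul_eq_mul]
    exact ((Φ.momentum L' c).map_add _ _).trans
      (congrArg _ ((Φ.momentum L' c).map_smul _ _))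
  have hσ' : ContMDiff 𝓘(ℝ, H) (𝓘(ℝ, H').prod 𝓘(ℝ, F')) ∞
      (fun x ↦ (⟨Φ.base x, Φ.fiber x (σ x)⟩ : TotalSpace F' V')) :=
    Φ.contMDiff_total.comp σ.contMDiff
  have key := dirDeriv_pairing (G := fun c : TotalSpace F V ↦ Φ.base c.proj) (n := a) fr
    (lam := Φ.momentum L') (s := s)
    (hs.mdifferentiable (by simp) a) hs0 (fun j ↦ (hηΦ (fr.sec j)).mdifferentiable (by simp) a)
    (by rw [hpair]; exact (hησ.sub (hηΦ η)).mdifferentiable (by simp) a) v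
  rw [hpair, dirDeriv_sub (hησ.mdifferentiable (by simp) a)
    ((hηΦ η).mdifferentiable (by simp) a)] at key
  have h1 : dirDeriv (𝓘(ℝ, H).prod 𝓘(ℝ, F))
      (fun c ↦ Φ.momentum L' c (η (Φ.base c.proj))) a v =
      dirDeriv (𝓘(ℝ, H').prod 𝓘(ℝ, F')) (fun c ↦ fiberDeriv (H := H') L' c (η c.proj)) (Φ.total a)
        (mfderiv (𝓘(ℝ, H).prod 𝓘(ℝ, F)) (𝓘(ℝ, H').prod 𝓘(ℝ, F')) Φ.total a v) :=
    dirDeriv_comp ((hη η).mdifferentiable (by simp) _) (Φ.mdifferentiableAt_total a) v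
  rw [← h1, key]
  refine Finset.sum_congr rfl fun j _ ↦ congrArg (· * _) ?_
  have hc1 : ContMDiff 𝓘(ℝ, H) 𝓘(ℝ, ℝ) ∞ (fun x ↦ fr.coord j (Φ.base x) (Φ.fiber x (σ x))) :=
    (fr.contMDiff_coord j).comp hσ'
  have hc2 : ContMDiff 𝓘(ℝ, H') 𝓘(ℝ, ℝ) ∞ (fun y ↦ fr.coord j y (η y)) :=
    (fr.contMDiff_coord j).comp η.contMDiff
  have hc2' := hc2.comp Φ.contMDiff_base
  have h2 : (fun c : TotalSpace F V ↦ fr.coord j (Φ.base c.proj) (s c)) = fun c ↦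
      fr.coord j (Φ.base c.proj) (Φ.fiber c.proj (σ c.proj)) -
        fr.coord j (Φ.base c.proj) (η (Φ.base c.proj)) := by
    ext c
    simp only [s, map_add, map_smul, smul_eq_mul, neg_one_mul, sub_eq_add_neg]
  rw [h2]
  refine (dirDeriv_sub ((hc1.comp hπ).mdifferentiable (by simp) a)
    ((hc2'.comp hπ).mdifferentiable (by simp) a) v).trans ?_
  refine congrArg₂ (· - ·) ?_ ?_
  · rw [hξ]
    exact dirDeriv_comp (hc1.mdifferentiable (by simp) _) (hπ.mdifferentiable (by simp) a) v
  · rw [hξ', hξ]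
    refine (dirDeriv_comp (hc2'.mdifferentiable (by simp) _)
      (hπ.mdifferentiable (by simp) a) v).trans ?_
    exact dirDeriv_comp (hc2.mdifferentiable (by simp) _) (Φ.mdifferentiableAt_base a.proj) _

/-- Each of the three terms of the difference of the two sides expands in the frame of `V'` with the
momenta of the frame sections as weights. The total coefficient of each weight is the defect of the
morphism condition for the 1-form `fr.coord j`, which is zero. -/
theorem IsMorphism.extDerivAlong_fiberDeriv (hΦ : Φ.IsMorphism A A')
    (hL' : ContMDiff (𝓘(ℝ, H').prod 𝓘(ℝ, F')) 𝓘(ℝ, ℝ) ∞ L') {a : TotalSpace F V}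
    {σ₁ σ₂ : Cₛ^∞⟮𝓘(ℝ, H); F, V⟯} {η₁ η₂ : Cₛ^∞⟮𝓘(ℝ, H'); F', V'⟯}
    (h₁ : Φ.fiber a.proj (σ₁ a.proj) = η₁ (Φ.base a.proj))
    (h₂ : Φ.fiber a.proj (σ₂ a.proj) = η₂ (Φ.base a.proj))
    {v₁ v₂ : TangentSpace (𝓘(ℝ, H).prod 𝓘(ℝ, F)) a}
    (hv₁ : A.anchor a.proj (σ₁ a.proj) =
      mfderiv (𝓘(ℝ, H).prod 𝓘(ℝ, F)) 𝓘(ℝ, H) (π F V) a v₁)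
    (hv₂ : A.anchor a.proj (σ₂ a.proj) =
      mfderiv (𝓘(ℝ, H).prod 𝓘(ℝ, F)) 𝓘(ℝ, H) (π F V) a v₂) :
    A.extDerivAlong (G := π F V) (fiberDeriv (H := H) (L' ∘ Φ.total)) a σ₁ σ₂ v₁ v₂ =
      A'.extDerivAlong (G := π F' V') (fiberDeriv (H := H') L') (Φ.total a) η₁ η₂
        (mfderiv (𝓘(ℝ, H).prod 𝓘(ℝ, F)) (𝓘(ℝ, H').prod 𝓘(ℝ, F')) Φ.total a v₁)
        (mfderiv (𝓘(ℝ, H).prod 𝓘(ℝ, F)) (𝓘(ℝ, H').prod 𝓘(ℝ, F')) Φ.total a v₂) := by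
  obtain ⟨fr⟩ := FrameAt.exists (H := H') (F := F') (V := V') (Φ.base a.proj)
  -- The indices cross: `v₁`, which lies over `ρ(σ₁)`, differentiates the momentum of the second
  -- section. Compatibility with the anchors identifies `Tφ(ρ(σ₁))` with `ρ'(η₁)` at the point.
  have d₂ := dirDeriv_momentum_sub hL' fr h₂ v₁ hv₁ (ξ' := A'.anchor _ (η₁ (Φ.base a.proj)))
    (by rw [← h₁, hΦ.anchor_fiber])
  have d₁ := dirDeriv_momentum_sub hL' fr h₁ v₂ hv₂ (ξ' := A'.anchor _ (η₂ (Φ.base a.proj)))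
    (by rw [← h₂, hΦ.anchor_fiber])
  have hb : fiberDeriv (H := H) (L' ∘ Φ.total) a (A.bracket σ₁ σ₂ a.proj) -
      Φ.momentum L' a (A'.bracket η₁ η₂ (Φ.base a.proj)) =
      ∑ j, (fr.coord j (Φ.base a.proj) (Φ.fiber a.proj (A.bracket σ₁ σ₂ a.proj)) -
        fr.coord j (Φ.base a.proj) (A'.bracket η₁ η₂ (Φ.base a.proj))) *
        Φ.momentum L' a (fr.sec j (Φ.base a.proj)) := by
    have hexp : ∀ b : V' (Φ.base a.proj), Φ.momentum L' a b =
        ∑ j, fr.coord j (Φ.base a.proj) b *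
          Φ.momentum L' a (fr.sec j (Φ.base a.proj)) := fun b ↦ by
      have hsum := fr.sum_coord _ b
      rw [fr.cutoff_self, one_smul] at hsum
      refine (congrArg (Φ.momentum L' a) hsum.symm).trans ?_
      refine (map_sum (Φ.momentum L' a) _ _).trans ?_
      exact Finset.sum_congr rfl fun j _ ↦ (Φ.momentum L' a).map_smul _ _
    rw [fiberDeriv_comp_total hL', hexp, hexp (A'.bracket η₁ η₂ (Φ.base a.proj)),
      ← Finset.sum_sub_distrib]
    exact Finset.sum_congr rfl fun j _ ↦ (sub_mul _ _ _).symm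
  have hm := fun j ↦ hΦ.extDerivAlong_comp_fiber (lam := fr.coord j)
    (fun σ ↦ (fr.contMDiff_coord j).comp σ.contMDiff) h₁ h₂
  rw [← sub_eq_zero]
  simp only [LieAlgebroid.extDerivAlong_def] at hm ⊢
  have hz : ∀ x₁ x₂ x₃ y₁ y₂ y₃ : ℝ, x₁ - x₂ - x₃ - (y₁ - y₂ - y₃) =
    (x₁ - y₁) - (x₂ - y₂) - (x₃ - y₃) := fun _ _ _ _ _ _ ↦ by ring
  rw [hz]
  refine (congrArg₂ (· - ·) (congrArg₂ (· - ·) d₂ d₁) hb).trans ?_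
  rw [← Finset.sum_sub_distrib, ← Finset.sum_sub_distrib]
  refine Finset.sum_eq_zero fun j _ ↦ ?_
  rw [← sub_mul, ← sub_mul]
  refine mul_eq_zero_of_left ?_ _
  have := hm j
  simp only [LinearMap.comp_apply] at this
  linarith

theorem IsMorphism.cartanTwoForm_prolong (hΦ : Φ.IsMorphism A A')
    (hL' : ContMDiff (𝓘(ℝ, H').prod 𝓘(ℝ, F')) 𝓘(ℝ, ℝ) ∞ L') {a : TotalSpace F V}
    (z₁ z₂ : A.Prol a) :
    A'.cartanTwoForm L' (Φ.total a) ![⟨_, hΦ.prolong_mem z₁⟩, ⟨_, hΦ.prolong_mem z₂⟩] =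
      A.cartanTwoForm (L' ∘ Φ.total) a ![z₁, z₂] := by
  obtain ⟨fr⟩ := FrameAt.exists (H := H) (F := F) (V := V) a.proj
  obtain ⟨fr'⟩ := FrameAt.exists (H := H') (F := F') (V := V') (Φ.base a.proj)
  have e := fr.extend_self
  have e' := fr'.extend_self
  rw [A.cartanTwoForm_apply (hL'.comp Φ.contMDiff_total') z₁ z₂ (e _) (e _),
    A'.cartanTwoForm_apply hL' ⟨_, hΦ.prolong_mem z₁⟩ ⟨_, hΦ.prolong_mem z₂⟩
      (e' (Φ.fiber a.proj (z₁ : Pair H a).1)) (e' (Φ.fiber a.proj (z₂ : Pair H a).1)), neg_inj]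
  refine (hΦ.extDerivAlong_fiberDeriv hL' ?_ ?_ ?_ ?_).symm
  · rw [e, e']
  · rw [e, e']
  · rw [e]; exact z₁.2
  · rw [e]; exact z₂.2

theorem IsMorphism.isRegularAt_total (hΦ : Φ.IsMorphism A A')
    (hsurj : ∀ x, Function.Surjective (Φ.fiber x))
    (hL' : ContMDiff (𝓘(ℝ, H').prod 𝓘(ℝ, F')) 𝓘(ℝ, ℝ) ∞ L') {a : TotalSpace F V}
    (hreg : A.IsRegularAt (L' ∘ Φ.total) a) : A'.IsRegularAt L' (Φ.total a) := by
  intro z' hz'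
  obtain ⟨z, hz⟩ := hΦ.exists_prolong_eq hsurj z'
  have hzz : z' = ⟨_, hΦ.prolong_mem z⟩ := Subtype.ext hz.symm
  have h0 : z = 0 := hreg z fun w ↦ by
    rw [← hΦ.cartanTwoForm_prolong hL', ← hzz]
    exact hz' _
  refine Subtype.ext (hz.symm.trans ?_)
  rw [h0]
  exact Prod.ext (map_zero (Φ.fiber a.proj)) (map_zero (mfderiv (𝓘(ℝ, H).prod 𝓘(ℝ, F))
    (𝓘(ℝ, H').prod 𝓘(ℝ, F')) Φ.total a))

theorem total_surjective (hbase : Function.Surjective Φ.base)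
    (hsurj : ∀ x, Function.Surjective (Φ.fiber x)) : Function.Surjective Φ.total := by
  rintro ⟨y, b'⟩
  obtain ⟨x, rfl⟩ := hbase y
  obtain ⟨b, rfl⟩ := hsurj x b'
  exact ⟨⟨x, b⟩, rfl⟩

theorem IsMorphism.prolong_isFreeDynamics (hΦ : Φ.IsMorphism A A')
    (hsurj : ∀ x, Function.Surjective (Φ.fiber x))
    (hL' : ContMDiff (𝓘(ℝ, H').prod 𝓘(ℝ, F')) 𝓘(ℝ, ℝ) ∞ L')
    (hreg : A.IsRegular (L' ∘ Φ.total)) {Γ : ∀ a, A.Prol a} {Γ' : ∀ a, A'.Prol a}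
    (hΓ : A.IsFreeDynamics (L' ∘ Φ.total) Γ) (hΓ' : A'.IsFreeDynamics L' Γ')
    (a : TotalSpace F V) : Φ.prolong a (Γ a) = Γ' (Φ.total a) := by
  have hun := (A'.existsUnique_dynamics (hΦ.isRegularAt_total hsurj hL' (hreg a))
    (energy H' L')).unique (y₁ := ⟨_, hΦ.prolong_mem (Γ a)⟩) (y₂ := Γ' (Φ.total a))
  -- It suffices that the image of `Γ a` solves the equation at `Φ(a)`. Each test vector `w'` lifts
  -- to some `w`, and both sides of the equation pull back to those for `L`.
  refine congrArg Subtype.val (hun (fun w' ↦ ?_) (hΓ' (Φ.total a)))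
  obtain ⟨w, hw⟩ := hΦ.exists_prolong_eq hsurj w'
  have hww : w' = ⟨_, hΦ.prolong_mem w⟩ := Subtype.ext hw.symm
  rw [hww, hΦ.cartanTwoForm_prolong hL', hΓ a w, prolD_energy_comp_total hL']

theorem isMIntegralCurveOn_comp_total {Γ : ∀ a, A.Prol a} {Γ' : ∀ a, A'.Prol a}
    (h : ∀ a, Φ.prolong a (Γ a) = Γ' (Φ.total a)) {c : ℝ → TotalSpace F V} {J : Set ℝ}
    (hc : IsMIntegralCurveOn c (LieAlgebroid.prolAnchor Γ) J) :
    IsMIntegralCurveOn (Φ.total ∘ c) (LieAlgebroid.prolAnchor Γ') J := by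
  intro t ht
  have h1 := (Φ.mdifferentiableAt_total (c t)).hasMFDerivAt.comp_hasMFDerivWithinAt t (hc t ht)
  have h2 : mfderiv (𝓘(ℝ, H).prod 𝓘(ℝ, F)) (𝓘(ℝ, H').prod 𝓘(ℝ, F')) Φ.total (c t)
      (LieAlgebroid.prolAnchor Γ (c t)) = LieAlgebroid.prolAnchor Γ' (Φ.total (c t)) :=
    congrArg Prod.snd (h (c t))
  refine (congrArg (HasMFDerivWithinAt 𝓘(ℝ, ℝ) (𝓘(ℝ, H').prod 𝓘(ℝ, F')) (Φ.total ∘ c) J t)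
    ?_).mp h1
  -- The two derivatives are linear maps on `ℝ`, compared through the velocities that generate them.
  refine ContinuousLinearMap.ext fun (r : ℝ) ↦ ?_
  refine ((mfderiv (𝓘(ℝ, H).prod 𝓘(ℝ, F)) (𝓘(ℝ, H').prod 𝓘(ℝ, F')) Φ.total (c t)).map_smul
    r _).trans ?_
  exact congrArg (fun w : H' × F' ↦ r • w) h2

end BundleMap

end Reduction

end LieAlgd

end

theorem mainTheorem4
    {H : Type*} [NormedAddCommGroup H] [NormedSpace ℝ H] [FiniteDimensional ℝ H]
    {M : Type*} [TopologicalSpace M] [ChartedSpace H M] [IsManifold 𝓘(ℝ, H) ∞ M] [T2Space M]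
    {F : Type*} [NormedAddCommGroup F] [NormedSpace ℝ F] [FiniteDimensional ℝ F]
    {V : M → Type*} [TopologicalSpace (TotalSpace F V)]
    [∀ x, TopologicalSpace (V x)] [∀ x, AddCommGroup (V x)] [∀ x, Module ℝ (V x)]
    [FiberBundle F V] [VectorBundle ℝ F V] [ContMDiffVectorBundle ∞ F V 𝓘(ℝ, H)]
    {H' : Type*} [NormedAddCommGroup H'] [NormedSpace ℝ H'] [FiniteDimensional ℝ H']
    {M' : Type*} [TopologicalSpace M'] [ChartedSpace H' M'] [IsManifold 𝓘(ℝ, H') ∞ M']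
    [T2Space M']
    {F' : Type*} [NormedAddCommGroup F'] [NormedSpace ℝ F'] [FiniteDimensional ℝ F']
    {V' : M' → Type*} [TopologicalSpace (TotalSpace F' V')]
    [∀ x, TopologicalSpace (V' x)] [∀ x, AddCommGroup (V' x)] [∀ x, Module ℝ (V' x)]
    [FiberBundle F' V'] [VectorBundle ℝ F' V'] [ContMDiffVectorBundle ∞ F' V' 𝓘(ℝ, H')]
    (A : LieAlgd.LieAlgebroid H F V) (A' : LieAlgd.LieAlgebroid H' F' V')
    (Φ : LieAlgd.BundleMap H F V H' F' V') (hΦ : Φ.IsMorphism A A')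
    (hsurj : ∀ x, Function.Surjective (Φ.fiber x))
    (L : TotalSpace F V → ℝ) (L' : TotalSpace F' V' → ℝ)
    (hL : ContMDiff (𝓘(ℝ, H).prod 𝓘(ℝ, F)) 𝓘(ℝ, ℝ) ∞ L)
    (hL' : ContMDiff (𝓘(ℝ, H').prod 𝓘(ℝ, F')) 𝓘(ℝ, ℝ) ∞ L')
    (hLL' : L = L' ∘ Φ.total) (hreg : A.IsRegular L) :
    -- `L'` is regular over `φ(M)`; it is a regular Lagrangian if `φ` is onto
    (∀ a, A'.IsRegularAt L' (Φ.total a)) ∧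
    (Function.Surjective Φ.base → A'.IsRegular L') ∧
    -- the solutions `Γ_L` and `Γ_{L'}` of the free dynamics exist and are unique
    (∃! Γ, A.IsFreeDynamics L Γ) ∧
    (Function.Surjective Φ.base → ∃! Γ', A'.IsFreeDynamics L' Γ') ∧
    ∀ Γ Γ', A.IsFreeDynamics L Γ → A'.IsFreeDynamics L' Γ' →
      -- `T^Φ Φ ∘ Γ_L = Γ_{L'} ∘ Φ`
      (∀ a, Φ.prolong a (Γ a) = Γ' (Φ.total a)) ∧
      -- `Φ` maps integral curves of `ρ¹(Γ_L)` to integral curves of `ρ¹(Γ_{L'})`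
      ∀ (c : ℝ → TotalSpace F V) (J : Set ℝ),
        IsMIntegralCurveOn c (LieAlgd.LieAlgebroid.prolAnchor Γ) J →
        IsMIntegralCurveOn (Φ.total ∘ c) (LieAlgd.LieAlgebroid.prolAnchor Γ') J := by
  subst hLL'
  have hr : ∀ a, A'.IsRegularAt L' (Φ.total a) := fun a ↦
    hΦ.isRegularAt_total hsurj hL' (hreg a)
  have hr' : Function.Surjective Φ.base → A'.IsRegular L' := fun hbase a' ↦ by
    obtain ⟨a, rfl⟩ := LieAlgd.BundleMap.total_surjective hbase hsurj a'
    exact hr a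
  refine ⟨hr, hr', A.existsUnique_isFreeDynamics hreg,
    fun hbase ↦ A'.existsUnique_isFreeDynamics (hr' hbase), fun Γ Γ' hΓ hΓ' ↦ ?_⟩
  have h := hΦ.prolong_isFreeDynamics hsurj hL' hreg hΓ hΓ'
  exact ⟨h, fun c J hc ↦ LieAlgd.BundleMap.isMIntegralCurveOn_comp_total h hc⟩
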